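/- Let $p$ be an odd prime, $F$ a field of characteristic $p$, and $L=\bigoplus_{i\ge 1}L_i$ an infinite-dimensional graded Lie algebra of maximal class over $F$; that is, $\dim L_1=2$, $\dim L_i\le 1$ for $i\ge 2$, and $L$ is generated by $L_1$. For $i\ge 2$ let $C_i=\{u\in L_1 : [L_i,u]=0\}$ be the two-step centralizers of $L$, and suppose that at least three of the subspaces $C_i$ $(i\ge 2)$ are distinct. Call the least $n$ with $C_n\ne C_2$ the length of the first constituent $C_2,\dots,C_n$. Every other constituent is a segment $C_{i+1},\dots,C_{i+m}$ with $i\ge 2$, $m\ge 1$, $C_i\ne C_2$, $C_{i+m}\ne C_2$ and $C_{i+1}=\dots=C_{i+m-1}=C_2$; its length is $m$. Then the first constituent has length $2q$, where $q=p^h$ for some $h\ge 1$, and every constituent of $L$ is either short (of length $q$) or long (of length $2q$). Moreover $L$ is inflated: there is a one-dimensional subspace $M$ of $(L^{\downarrow})_1$ such that $L$ is isomorphic, as a graded Lie algebra, to the inflation ${}^{M}(L^{\downarrow})$ of its deflation $L^{\downarrow}$. Here: * The deflation is $L^{\downarrow}=\bigl(\bigoplus_{i\ge 1}L_{pi}\bigr)\oplus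 F\delta$, the extension of the subalgebra $\bigoplus_{i\ge1} L_{pi}$ by its derivation $\delta=(\operatorname{ad}x)^p$, where $x\in L_1\setminus C_2$ (the choice of $x$ does not matter up to graded isomorphism); $L_{pi}$ has weight $i$ and $\delta$ has weight $1$. * For a graded Lie algebra $N=\bigoplus_{i\ge1}N_i$ of maximal class and a one-dimensional subspace $M$ of $N_1$, let $I=M\oplus\bigoplus_{i\ge 2}N_i$ and $s\in N_1\setminus M$. The inflation is ${}^{M}N=\bigl(F[\varepsilon]/(\varepsilon^p)\otimes_F I\bigr)\oplus FD$, the extension by the derivation $D=\frac{d}{d\varepsilon}\otimes 1+\varepsilon^{p-1}\otimes\operatorname{ad}s$ (the choice of $s$ does not matter up to graded isomorphism); $\varepsilon^j\otimes m$ has weight $pi-j$ for $m\in I\cap N_i$ and $0\le j<p$, and $D$ has weight $1$. -/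

import Mathlib

open scoped TensorProduct Polynomial

namespace MaximalClass

/-! ### Graded Lie algebras of maximal class, two-step centralizers, constituents -/

section Basic

variable {F L : Type*} [Field F] [LieRing L] [LieAlgebra F L]

/-- A Lie algebra `L = ⨁_{i ≥ 1} L_i` (the grading is indexed by `ℕ`, with `L_0 = 0`) is of
maximal class when `dim L_1 = 2`, `dim L_i ≤ 1` for `i ≥ 2`, and `L_1` generates `L`. -/
structure IsMaximalClass (𝒜 : ℕ → Submodule F L) [GradedLieAlgebra 𝒜] : Prop where
  zero_eq_bot : 𝒜 0 = ⊥
  rank_one : Module.rank F (𝒜 1) = 2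
  rank_le_one : ∀ i, 2 ≤ i → Module.rank F (𝒜 i) ≤ 1
  generated : LieSubalgebra.lieSpan F L (𝒜 1 : Set L) = ⊤

/-- `C_i = C_{L_1}(L_i)`, the centralizer of `L_i` in `L_1`. -/
def twoStepCentralizer (𝒜 : ℕ → Submodule F L) (i : ℕ) : Submodule F L where
  carrier := {u | u ∈ 𝒜 1 ∧ ∀ v ∈ 𝒜 i, ⁅v, u⁆ = 0}
  add_mem' := fun ha hb =>
    ⟨add_mem ha.1 hb.1, fun v hv => by rw [lie_add, ha.2 v hv, hb.2 v hv, add_zero]⟩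
  zero_mem' := ⟨zero_mem _, fun v _ => lie_zero v⟩
  smul_mem' := fun c _ ha =>
    ⟨Submodule.smul_mem _ c ha.1, fun v hv => by rw [lie_smul, ha.2 v hv, smul_zero]⟩

/-- The set of two-step centralizers `{C_i : i ≥ 2}`. -/
def twoStepCentralizers (𝒜 : ℕ → Submodule F L) : Set (Submodule F L) :=
  {C | ∃ i, 2 ≤ i ∧ C = twoStepCentralizer 𝒜 i}

/-- The second two-step centralizer (in order of occurrence) first occurs in weight `n`. -/
def SecondOccursAt (𝒜 : ℕ → Submodule F L) (n : ℕ) : Prop :=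
  2 ≤ n ∧ twoStepCentralizer 𝒜 n ≠ twoStepCentralizer 𝒜 2 ∧
    ∀ j, 2 ≤ j → j < n → twoStepCentralizer 𝒜 j = twoStepCentralizer 𝒜 2

/-- `q` is the parameter: the second two-step centralizer first occurs in weight `2q`. -/
def IsParameter (𝒜 : ℕ → Submodule F L) (q : ℕ) : Prop :=
  SecondOccursAt 𝒜 (2 * q)

/-- `IsConstituent 𝒜 a b m` means that `C_a, C_{a+1}, …, C_b` is a constituent, of length `m`.
The first constituent `C_2, …, C_n` is given the length `n` by convention. -/
inductive IsConstituent (𝒜 : ℕ → Submodule F L) : ℕ → ℕ → ℕ → Prop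
  | first (n : ℕ) (h : SecondOccursAt 𝒜 n) : IsConstituent 𝒜 2 n n
  | later (i m : ℕ) (hi : 2 ≤ i) (hm : 1 ≤ m)
      (hstart : twoStepCentralizer 𝒜 i ≠ twoStepCentralizer 𝒜 2)
      (hend : twoStepCentralizer 𝒜 (i + m) ≠ twoStepCentralizer 𝒜 2)
      (hmid : ∀ j, 1 ≤ j → j < m → twoStepCentralizer 𝒜 (i + j) = twoStepCentralizer 𝒜 2) :
      IsConstituent 𝒜 (i + 1) (i + m) m

end Basic

/-! ### Extension of a Lie algebra by a derivation -/

section DerivExt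

variable {F K : Type*} [Field F] [LieRing K] [LieAlgebra F K]

/-- The Lie algebra `K ⊕ F·D`, with `⁅D, a⁆ = D a` for `a ∈ K`. The pair `⟨a, t⟩` stands for
`a + t D`. -/
@[ext] structure DerivExt (D : LieDerivation F K K) where
  left : K
  right : F

namespace DerivExt

variable (D : LieDerivation F K K)

variable {D} in
def toProd : DerivExt D ≃ K × F where
  toFun x := ⟨x.left, x.right⟩
  invFun x := ⟨x.1, x.2⟩
  left_inv _ := rfl
  right_inv _ := rfl

instance : AddCommGroup (DerivExt D) := toProd.addCommGroup

instance : Module F (DerivExt D) := toProd.module F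

instance : Bracket (DerivExt D) (DerivExt D) where
  bracket x y := ⟨⁅x.left, y.left⁆ + x.right • D y.left - y.right • D x.left, 0⟩

@[simp] lemma zero_eq_mk : (0 : DerivExt D) = ⟨0, 0⟩ := rfl
@[simp] lemma add_eq_mk (x y : DerivExt D) :
    x + y = ⟨x.left + y.left, x.right + y.right⟩ := rfl
@[simp] lemma smul_eq_mk (t : F) (x : DerivExt D) :
    t • x = ⟨t • x.left, t • x.right⟩ := rfl
@[simp] lemma lie_eq_mk (x y : DerivExt D) :
    ⁅x, y⁆ = ⟨⁅x.left, y.left⁆ + x.right • D y.left - y.right • D x.left, 0⟩ := rfl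

instance : LieRing (DerivExt D) where
  add_lie x y z := by
    ext
    · simp [add_smul]; abel
    · simp
  lie_add x y z := by
    ext
    · simp [add_smul]; abel
    · simp
  lie_self x := by simp
  leibniz_lie x y z := by
    ext
    · simp only [lie_eq_mk, add_eq_mk, lie_add, lie_sub, add_lie, sub_lie, lie_smul, smul_lie,
        map_add, map_sub, map_smul, smul_add, smul_sub, zero_smul,
        LieDerivation.apply_lie_eq_add, smul_smul, mul_comm y.right x.right,
        mul_comm z.right x.right, mul_comm z.right y.right]
      rw [leibniz_lie x.left, ← lie_skew (D x.left) z.left, ← lie_skew (D y.left) z.left,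
        ← lie_skew (D x.left) y.left]
      simp only [smul_neg]
      abel
    · simp

instance : LieAlgebra F (DerivExt D) where
  lie_smul t x y := by
    ext
    · simp [smul_sub, smul_add, smul_smul, mul_comm]
    · simp

/-- The inclusion of `K` in `K ⊕ F·D`. -/
def inl : K →ₗ[F] DerivExt D where
  toFun a := ⟨a, 0⟩
  map_add' _ _ := by simp
  map_smul' _ _ := by simp

/-- The element `D` of `K ⊕ F·D`. -/
def gen : DerivExt D := ⟨0, 1⟩

end DerivExt

end DerivExt

/-! ### Deflation -/

section Deflation

variable {F L : Type*} [Field F] [LieRing L] [LieAlgebra F L]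

/-- The subalgebra `⨁_i L_{pi}` of a graded Lie algebra. -/
def multiplesSubalgebra (p : ℕ) (𝒜 : ℕ → Submodule F L) [SetLike.GradedBracket 𝒜] :
    LieSubalgebra F L where
  toSubmodule := ⨆ i, 𝒜 (p * i)
  lie_mem' := by
    intro a b ha hb
    change a ∈ ⨆ i, 𝒜 (p * i) at ha
    change b ∈ ⨆ i, 𝒜 (p * i) at hb
    change ⁅a, b⁆ ∈ ⨆ i, 𝒜 (p * i)
    induction ha using Submodule.iSup_induction' with
    | zero => simp
    | add x y _ _ hx hy => rw [add_lie]; exact add_mem hx hy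
    | mem i x hx =>
      induction hb using Submodule.iSup_induction' with
      | zero => simp
      | add y z _ _ hy hz => rw [lie_add]; exact add_mem hy hz
      | mem j y hy =>
        refine Submodule.mem_iSup_of_mem (i + j) ?_
        rw [mul_add]
        exact SetLike.GradedBracket.bracket_mem hx hy

lemma ad_pow_mem (𝒜 : ℕ → Submodule F L) [SetLike.GradedBracket 𝒜] {x : L} (hx : x ∈ 𝒜 1)
    (n i : ℕ) {a : L} (ha : a ∈ 𝒜 i) : (LieAlgebra.ad F L x ^ n) a ∈ 𝒜 (i + n) := by
  induction n with
  | zero => simpa using ha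
  | succ n ih =>
    rw [pow_succ', Module.End.mul_apply, LieAlgebra.ad_apply,
      show i + (n + 1) = 1 + (i + n) by ring]
    exact SetLike.GradedBracket.bracket_mem hx ih

lemma ad_pow_mem_multiples (p : ℕ) (𝒜 : ℕ → Submodule F L) [SetLike.GradedBracket 𝒜] {x : L}
    (hx : x ∈ 𝒜 1) (a : L) (ha : a ∈ multiplesSubalgebra p 𝒜) :
    (LieAlgebra.ad F L x ^ p) a ∈ multiplesSubalgebra p 𝒜 := by
  change a ∈ ⨆ i, 𝒜 (p * i) at ha
  change _ ∈ ⨆ i, 𝒜 (p * i)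
  induction ha using Submodule.iSup_induction' with
  | zero => simp
  | add y z _ _ hy hz => rw [map_add]; exact add_mem hy hz
  | mem i y hy =>
    refine Submodule.mem_iSup_of_mem (i + 1) ?_
    rw [mul_add, mul_one]
    exact ad_pow_mem 𝒜 hx p _ hy

/-- In characteristic `p`, the `p`-th power of an inner derivation is a derivation. -/
lemma ad_pow_char_lie (p : ℕ) [hp : Fact p.Prime] [CharP F p] (x a b : L) :
    (LieAlgebra.ad F L x ^ p) ⁅a, b⁆ =
      ⁅(LieAlgebra.ad F L x ^ p) a, b⁆ + ⁅a, (LieAlgebra.ad F L x ^ p) b⁆ := by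
  have key := LieDerivation.iterate_apply_lie' (LieDerivation.ad F L x) p a b
  have hfun : (⇑(LieDerivation.ad F L x)) = ⇑(LieAlgebra.ad F L x) := by
    funext y; simp
  rw [hfun] at key
  simp only [← Module.End.pow_apply] at key
  obtain ⟨n, hn⟩ : ∃ n, p = n + 1 := ⟨p - 1, (Nat.succ_pred_prime hp.out).symm⟩
  rw [key, Finset.sum_range_succ]
  rw [show Finset.range p = Finset.range (n + 1) by rw [hn], Finset.sum_range_succ',
    Finset.sum_eq_zero]
  · simp [add_comm]
  · intro i hi
    have hlt : i + 1 < p := by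
      have := Finset.mem_range.mp hi
      omega
    have hdvd : p ∣ p.choose (i + 1) := hp.out.dvd_choose_self (Nat.succ_ne_zero i) hlt
    rw [← Nat.cast_smul_eq_nsmul F, (CharP.cast_eq_zero_iff F p _).mpr hdvd, zero_smul]

/-- The derivation of `⨁_i L_{pi}` induced by `(ad x)^p`, for `x ∈ L_1`. -/
def adPowDerivation (p : ℕ) [Fact p.Prime] [CharP F p] (𝒜 : ℕ → Submodule F L)
    [SetLike.GradedBracket 𝒜] (x : 𝒜 1) :
    LieDerivation F (multiplesSubalgebra p 𝒜) (multiplesSubalgebra p 𝒜) where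
  toLinearMap := (LieAlgebra.ad F L (x : L) ^ p).restrict
    (p := (multiplesSubalgebra p 𝒜).toSubmodule) (q := (multiplesSubalgebra p 𝒜).toSubmodule)
    (ad_pow_mem_multiples p 𝒜 x.2)
  leibniz' a b := by
    apply Subtype.ext
    have := ad_pow_char_lie (F := F) p (x : L) (a : L) (b : L)
    change (LieAlgebra.ad F L (x : L) ^ p) ⁅(a : L), (b : L)⁆ =
      ⁅(a : L), (LieAlgebra.ad F L (x : L) ^ p) (b : L)⁆ -
        ⁅(b : L), (LieAlgebra.ad F L (x : L) ^ p) (a : L)⁆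
    rw [this, ← lie_skew (b : L)]
    abel

/-- The deflation of `L`: the algebra `⨁_i L_{pi}` extended by the derivation `(ad x)^p`.
Here `x ∈ L_1` is an element outside `C_2`; up to isomorphism of graded algebras the deflation of
an algebra of maximal class does not depend on `x`. -/
abbrev Deflation (p : ℕ) [Fact p.Prime] [CharP F p] (𝒜 : ℕ → Submodule F L)
    [SetLike.GradedBracket 𝒜] (x : 𝒜 1) : Type _ :=
  DerivExt (adPowDerivation p 𝒜 x)

/-- The grading of the deflation: `L_{pk}` has weight `k`, and `(ad x)^p` has weight `1`. -/
def deflationGrading (p : ℕ) [Fact p.Prime] [CharP F p] (𝒜 : ℕ → Submodule F L)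
    [SetLike.GradedBracket 𝒜] (x : 𝒜 1) (k : ℕ) : Submodule F (Deflation p 𝒜 x) :=
  ((𝒜 (p * k)).comap (multiplesSubalgebra p 𝒜).toSubmodule.subtype).map (DerivExt.inl _) ⊔
    if k = 1 then Submodule.span F {DerivExt.gen (adPowDerivation p 𝒜 x)} else ⊥

end Deflation

/-! ### Inflation -/

section Inflation

/-- The truncated polynomial algebra `F[ε]` with `ε ^ p = 0`. -/
abbrev Trunc (F : Type*) [Field F] (p : ℕ) : Type _ :=
  F[X] ⧸ Ideal.span {(Polynomial.X : F[X]) ^ p}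

/-- The class `ε` of the indeterminate. -/
noncomputable def eps (F : Type*) [Field F] (p : ℕ) : Trunc F p :=
  Ideal.Quotient.mk _ Polynomial.X

lemma derivative_trunc (F : Type*) [Field F] (p : ℕ) [CharP F p] (f : F[X])
    (hf : Ideal.Quotient.mkₐ F (Ideal.span {(Polynomial.X : F[X]) ^ p}) f = 0) :
    Ideal.Quotient.mkₐ F (Ideal.span {(Polynomial.X : F[X]) ^ p})
      (Polynomial.derivative' f) = 0 := by
  rw [Ideal.Quotient.mkₐ_eq_mk, Ideal.Quotient.eq_zero_iff_mem, Ideal.mem_span_singleton] at hf ⊢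
  obtain ⟨g, rfl⟩ := hf
  refine ⟨Polynomial.derivative g, ?_⟩
  simp [Polynomial.derivative']

/-- The derivation `∂ = d/dε` of `F[ε]`, well defined since `F` has characteristic `p`. -/
noncomputable def truncDerivation (F : Type*) [Field F] (p : ℕ) [CharP F p] :
    Derivation F (Trunc F p) (Trunc F p) :=
  Derivation.liftOfSurjective (d := (Polynomial.derivative' : Derivation F F[X] F[X]))
    (Ideal.Quotient.mkₐ_surjective F (Ideal.span {(Polynomial.X : F[X]) ^ p}))
    (derivative_trunc F p)

variable {F N : Type*} [Field F] [LieRing N] [LieAlgebra F N]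

/-- The derivation `m ↦ ⁅s, m⁆` of an ideal `I` of `N`, for `s ∈ N`. -/
def adIdeal (I : LieIdeal F N) (s : N) : LieDerivation F I I where
  toLinearMap := LieModule.toEnd F N I s
  leibniz' a b := by
    apply Subtype.ext
    change ⁅s, ⁅(a : N), (b : N)⁆⁆ = ⁅(a : N), ⁅s, (b : N)⁆⁆ - ⁅(b : N), ⁅s, (a : N)⁆⁆
    rw [leibniz_lie s, ← lie_skew (b : N)]
    abel

/-- The derivation `D = ∂ ⊗ 1 + ε^{p-1} ⊗ ad s` of `F[ε] ⊗ I`. -/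
noncomputable def inflationDerivation (p : ℕ) [CharP F p] (I : LieIdeal F N) (s : N) :
    LieDerivation F (Trunc F p ⊗[F] I) (Trunc F p ⊗[F] I) :=
  Lie.Derivation.ofDerivation I (truncDerivation F p) +
    eps F p ^ (p - 1) • Lie.Derivation.ofLieDerivation (Trunc F p) (adIdeal I s)

/-- The inflation of a graded algebra `N` of maximal class: if `I = M ⊕ ⨁_{i ≥ 2} N_i`, where `M`
is a one-dimensional subspace of `N_1`, and `s ∈ N_1 ∖ M`, then it is `F[ε] ⊗ I` extended by the
derivation `D = ∂ ⊗ 1 + ε^{p-1} ⊗ ad s`. -/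
abbrev Inflation (p : ℕ) [CharP F p] (I : LieIdeal F N) (s : N) : Type _ :=
  DerivExt (inflationDerivation p I s)

/-- The grading of the inflation: for `m ∈ I` of weight `i` in `N` and `0 ≤ j < p`, the element
`ε^j ⊗ m` has weight `p i - j`; the derivation `D` has weight `1`. -/
noncomputable def inflationGrading (p : ℕ) [CharP F p] (ℬ : ℕ → Submodule F N) (I : LieIdeal F N)
    (s : N) (k : ℕ) : Submodule F (Inflation p I s) :=
  Submodule.span F {v | ∃ (i j : ℕ) (m : I), j < p ∧ k + j = p * i ∧ (m : N) ∈ ℬ i ∧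
      v = DerivExt.inl _ ((eps F p ^ j) ⊗ₜ[F] m)} ⊔
    if k = 1 then Submodule.span F {DerivExt.gen (inflationDerivation p I s)} else ⊥

end Inflation

section Inflated

variable {F L : Type*} [Field F] [LieRing L] [LieAlgebra F L]

/-- `L` is inflated: it is isomorphic, as a graded Lie algebra, to the inflation of its deflation
with respect to a one-dimensional subspace `M` of the weight one component of the deflation. -/
def IsInflated (p : ℕ) [Fact p.Prime] [CharP F p] (𝒜 : ℕ → Submodule F L)
    [SetLike.GradedBracket 𝒜] : Prop :=
  ∃ x : 𝒜 1, (x : L) ∉ twoStepCentralizer 𝒜 2 ∧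
  ∃ M : Submodule F (Deflation p 𝒜 x),
    M ≤ deflationGrading p 𝒜 x 1 ∧ Module.finrank F M = 1 ∧
  ∃ I : LieIdeal F (Deflation p 𝒜 x),
    I.toSubmodule = M ⊔ (⨆ i, ⨆ (_ : 2 ≤ i), deflationGrading p 𝒜 x i) ∧
  ∃ s ∈ deflationGrading p 𝒜 x 1, s ∉ M ∧
  ∃ e : L ≃ₗ⁅F⁆ Inflation p I s,
    ∀ k, (𝒜 k).map (e : L →ₗ[F] Inflation p I s) =
      inflationGrading p (deflationGrading p 𝒜 x) I s k

end Inflated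

end MaximalClass

namespace MaximalClass

/-! Choose `y` in `C_2`. Over the rational function field the element `z = x + X y` centralizes no
`L_k` with `k ≥ 1`, so `w_1 = y`, `w_{k+1} = ⁅z, w_k⁆` never vanish and `⁅y, w_k⁆ = f k • w_{k+1}`
defines a scalar sequence. For `k, l ≥ 2`, `f k = 0` exactly when `C_k = C_2`, and `f k = f l`
forces `C_k = C_l`. The structure constants of the `w_k` are iterated differences of `f`, so the
Jacobi identity and skew-symmetry become the relations in `IsCentralizerSequence`.

The numerical half concerns such sequences only. Windows with a single nonzero term turn the
relations into divisibilities of binomial coefficients: the first nonzero index is `2q` with `q` a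
power of `p` (`exists_eq_prime_pow`), and nonzero terms are at least `q` apart (`le_gap`) and at
most `2q` to the next (`exists_next`). In characteristic `p`, differences of order `q(n+1) - 1` are
`n`-th differences of sums over blocks of length `q`. With these, a second nonzero value of `f` (a
third centralizer) forces all nonzero indices to be multiples of `q` (`dvd_of_ne_zero`), so gaps are
`q` or `2q`.

In particular `y` acts nontrivially only in weights divisible by `p`. Then `x ↦ D`, `v_{p(i+1)-j} ↦
ε^j / j! ⊗ v_{p(i+1)}` is an isomorphism onto the inflation with `M = F v_p` and `s = -δ`
(`IsStandardBasis.isInflated`): dividing by `j!` makes `d/dε` act as `ad x`, and since `L_1`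
generates `L` only brackets with `x` and `y` need checking. -/

/-! ### Iterated differences of a sequence -/

section Differences

variable {K : Type*}

/-- The `j`-th iterate of the difference operator `f ↦ f i - f (i + 1)`. -/
def diff [AddCommGroup K] (f : ℕ → K) : ℕ → ℕ → K
  | 0, i => f i
  | j + 1, i => diff f j i - diff f j (i + 1)

@[simp] lemma diff_zero [AddCommGroup K] (f : ℕ → K) (i : ℕ) : diff f 0 i = f i := rfl

lemma diff_succ [AddCommGroup K] (f : ℕ → K) (j i : ℕ) :
    diff f (j + 1) i = diff f j i - diff f j (i + 1) := rfl

lemma diff_congr [AddCommGroup K] {f g : ℕ → K} {j i i' : ℕ}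
    (h : ∀ k ≤ j, f (i + k) = g (i' + k)) : diff f j i = diff g j i' := by
  induction j generalizing i i' with
  | zero => simpa using h 0 le_rfl
  | succ j ih =>
    rw [diff_succ, diff_succ, ih fun k hk => h k (by omega),
      ih (i := i + 1) (i' := i' + 1) fun k hk => by
        have := h (k + 1) (by omega)
        rwa [show i + 1 + k = i + (k + 1) by ring, show i' + 1 + k = i' + (k + 1) by ring]]

lemma diff_eq_zero [AddCommGroup K] {f : ℕ → K} {j i : ℕ} (h : ∀ k ≤ j, f (i + k) = 0) :
    diff f j i = 0 := by
  induction j generalizing i with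
  | zero => simpa using h 0 le_rfl
  | succ j ih =>
    rw [diff_succ, ih fun k hk => h k (by omega),
      ih (i := i + 1) fun k hk => by
        rw [show i + 1 + k = i + (k + 1) by ring]; exact h (k + 1) (by omega), sub_zero]

lemma diff_sub [AddCommGroup K] (f g : ℕ → K) (j i : ℕ) :
    diff (fun k => f k - g k) j i = diff f j i - diff g j i := by
  induction j generalizing i with
  | zero => rfl
  | succ j ih => rw [diff_succ, diff_succ, diff_succ, ih, ih]; abel

lemma diff_eq_sum [Ring K] (f : ℕ → K) (j i : ℕ) :
    diff f j i = ∑ k ∈ Finset.range (j + 1), (-1) ^ k * (j.choose k : K) * f (i + k) := by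
  induction j generalizing i with
  | zero => simp
  | succ j ih =>
    rw [diff_succ, ih, ih, Finset.sum_range_succ' _ (j + 1), Finset.sum_range_succ' _ j]
    have h : ∑ k ∈ Finset.range (j + 1),
        (-1) ^ (k + 1) * ((j + 1).choose (k + 1) : K) * f (i + (k + 1)) =
        ∑ k ∈ Finset.range (j + 1), (-1) ^ (k + 1) * (j.choose (k + 1) : K) * f (i + (k + 1)) -
        ∑ k ∈ Finset.range (j + 1), (-1) ^ k * (j.choose k : K) * f (i + 1 + k) := by
      rw [← Finset.sum_sub_distrib]
      refine Finset.sum_congr rfl fun k _ => ?_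
      rw [Nat.choose_succ_succ, show i + 1 + k = i + (k + 1) by ring, pow_succ]
      push_cast
      noncomm_ring
    have h' : ∑ k ∈ Finset.range (j + 1),
        (-1) ^ (k + 1) * (j.choose (k + 1) : K) * f (i + (k + 1)) =
        ∑ k ∈ Finset.range j, (-1) ^ (k + 1) * (j.choose (k + 1) : K) * f (i + (k + 1)) := by
      rw [Finset.sum_range_succ]; simp
    rw [h, h']
    simp only [Nat.choose_zero_right]
    abel

/-- When a window of the sequence has one nonzero term, a relation between differences becomes a
statement about one binomial coefficient. -/
lemma diff_eq_single [Ring K] {f : ℕ → K} {j i r : ℕ} (hr : r ≤ j)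
    (h : ∀ k ≤ j, k ≠ r → f (i + k) = 0) :
    diff f j i = (-1) ^ r * (j.choose r : K) * f (i + r) := by
  rw [diff_eq_sum, Finset.sum_eq_single r]
  · intro k hk hkr
    rw [h k (by simpa [Nat.lt_succ_iff] using hk) hkr, mul_zero]
  · intro hr'
    exact absurd (Finset.mem_range.mpr (by omega)) hr'

lemma diff_eq_last [Ring K] {f : ℕ → K} {j i : ℕ} (h : ∀ k < j, f (i + k) = 0) :
    diff f j i = (-1) ^ j * f (i + j) := by
  rw [diff_eq_single le_rfl fun k hk hkj => h k (by omega)]; simp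

lemma diff_eq_first [Ring K] {f : ℕ → K} {j i : ℕ} (h : ∀ k ≤ j, 1 ≤ k → f (i + k) = 0) :
    diff f j i = f i := by
  rw [diff_eq_single (Nat.zero_le j) fun k hk hkj => h k hk (by omega)]; simp

/-- A sequence is determined by its iterated differences at the origin. -/
lemma eq_of_diff_eq [Ring K] {f g : ℕ → K} {n : ℕ} (h : ∀ j ≤ n, diff f j 0 = diff g j 0) :
    ∀ l ≤ n, f l = g l := by
  intro l
  induction l using Nat.strong_induction_on with
  | _ l ih =>
    intro hl
    have h1 : diff (fun k => f k - g k) l 0 = (-1) ^ l * (f (0 + l) - g (0 + l)) :=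
      diff_eq_last fun k hk => by
        simp only [zero_add]
        rw [ih k hk (by omega), sub_self]
    rw [diff_sub, h l hl, sub_self, zero_add] at h1
    rcases neg_one_pow_eq_or K l with h2 | h2 <;> rw [h2] at h1
    · rw [one_mul] at h1; exact sub_eq_zero.mp h1.symm
    · rw [neg_one_mul, zero_eq_neg] at h1; exact sub_eq_zero.mp h1

/-- Sums over blocks of length `q`. -/
def blockSum [AddCommGroup K] (f : ℕ → K) (q i : ℕ) : K := ∑ k ∈ Finset.range q, f (i + k)

lemma blockSum_succ [AddCommGroup K] (f : ℕ → K) (q i : ℕ) :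
    blockSum f q (i + 1) = blockSum f q i + f (i + q) - f i := by
  have h1 := Finset.sum_range_succ (fun k => f (i + k)) q
  have h2 := Finset.sum_range_succ' (fun k => f (i + k)) q
  have h3 : blockSum f q (i + 1) = ∑ k ∈ Finset.range q, f (i + (k + 1)) :=
    Finset.sum_congr rfl fun k _ => by rw [show i + 1 + k = i + (k + 1) by ring]
  rw [h3, blockSum, ← h1, h2]; simp

lemma blockSum_eq_zero [AddCommGroup K] {f : ℕ → K} {q i : ℕ} (h : ∀ k < q, f (i + k) = 0) :
    blockSum f q i = 0 :=
  Finset.sum_eq_zero fun k hk => h k (Finset.mem_range.mp hk)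

lemma blockSum_eq_single [AddCommGroup K] {f : ℕ → K} {q i r : ℕ} (hr : r < q)
    (h : ∀ k < q, k ≠ r → f (i + k) = 0) : blockSum f q i = f (i + r) :=
  Finset.sum_eq_single_of_mem r (Finset.mem_range.mpr hr)
    fun k hk => h k (Finset.mem_range.mp hk)

open Polynomial in
-- By Frobenius, both sides become `(1 - X ^ q) ^ (n + 1)`, with `q = p ^ h`, after multiplication
-- by `1 - X`.
lemma one_sub_X_pow_pred [Field K] (p : ℕ) [Fact p.Prime] [CharP K p] (h n : ℕ) :
    (1 - X : K[X]) ^ (p ^ h * (n + 1) - 1) =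
      (1 - X ^ p ^ h) ^ n * ∑ k ∈ Finset.range (p ^ h), X ^ k := by
  have hq : 0 < p ^ h := pow_pos (Fact.out : p.Prime).pos h
  have h0 : (1 - X : K[X]) ≠ 0 := fun h' => by
    simpa using congrArg (eval 0) h'
  have h1 : (1 - X : K[X]) ^ p ^ h = 1 - X ^ p ^ h := by
    rw [sub_pow_expChar_pow (p := p), one_pow]
  apply mul_right_cancel₀ h0
  rw [← pow_succ, mul_assoc, mul_comm (∑ k ∈ _, _), mul_neg_geom_sum, ← pow_succ, ← h1, ← pow_mul]
  congr 1
  have : 0 < p ^ h * (n + 1) := by positivity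
  omega

/-- The shift operator on sequences. -/
def shift (K : Type*) [Field K] : Module.End K (ℕ → K) := LinearMap.funLeft K K (· + 1)

open Polynomial in
lemma aeval_shift_X_pow [Field K] (f : ℕ → K) (k i : ℕ) :
    aeval (shift K) (X ^ k : K[X]) f i = f (i + k) := by
  induction k generalizing i with
  | zero => simp
  | succ k ih =>
    rw [pow_succ', map_mul, aeval_X, Module.End.mul_apply]
    change aeval (shift K) (X ^ k : K[X]) f (i + 1) = _
    rw [ih]; congr 1; ring

open Polynomial in
lemma aeval_shift_diff [Field K] (f : ℕ → K) (q n i : ℕ) :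
    aeval (shift K) ((1 - X ^ q : K[X]) ^ n) f i = diff (fun l => f (i + q * l)) n 0 := by
  induction n generalizing i with
  | zero => simp
  | succ n ih =>
    rw [pow_succ', sub_mul, one_mul, map_sub, LinearMap.sub_apply, Pi.sub_apply, map_mul,
      Module.End.mul_apply, aeval_shift_X_pow, ih, ih, diff_succ]
    congr 1
    refine diff_congr fun k _ => ?_
    congr 1; ring

open Polynomial in
/-- In characteristic `p`, differences whose order is one less than a multiple of `q = p ^ h` are
differences of sums over blocks of length `q`. -/
lemma diff_block [Field K] (p : ℕ) [Fact p.Prime] [CharP K p] (f : ℕ → K) (h n i : ℕ) :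
    diff f (p ^ h * (n + 1) - 1) i = diff (fun l => blockSum f (p ^ h) (i + p ^ h * l)) n 0 := by
  have h1 := aeval_shift_diff f 1 (p ^ h * (n + 1) - 1) i
  rw [pow_one, one_sub_X_pow_pred, map_mul, Module.End.mul_apply, aeval_shift_diff] at h1
  have h2 : ∀ m, aeval (shift K) (∑ k ∈ Finset.range (p ^ h), (X ^ k : K[X])) f m =
      blockSum f (p ^ h) m := fun m => by
    rw [map_sum, LinearMap.sum_apply, Finset.sum_apply]
    exact Finset.sum_congr rfl fun k _ => aeval_shift_X_pow f k m
  simp only [h2] at h1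
  rw [h1]
  exact diff_congr fun k _ => by simp

end Differences

/-! ### Binomial coefficients modulo a prime -/

/-- Lucas: dividing both arguments by `p` strips a last digit, which is `0` in the lower one, until
the lower argument is `1`. -/
lemma choose_prime_pow_modEq (p : ℕ) [Fact p.Prime] (e u s : ℕ) (hs : s < p ^ e) :
    (p ^ e * u + s).choose (p ^ e) ≡ u [MOD p] := by
  have hp := (Fact.out : p.Prime)
  induction e generalizing s with
  | zero =>
    have : s = 0 := by simpa using hs
    subst this; simp [Nat.ModEq.refl]
  | succ e ih =>
    refine (Choose.choose_modEq_choose_mod_mul_choose_div_nat (p := p)).trans ?_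
    have h1 : p ^ (e + 1) % p = 0 := by simp [pow_succ]
    have h2 : p ^ (e + 1) / p = p ^ e := by rw [pow_succ]; exact Nat.mul_div_cancel _ hp.pos
    have h3 : (p ^ (e + 1) * u + s) / p = p ^ e * u + s / p := by
      rw [pow_succ, show p ^ e * p * u + s = s + p * (p ^ e * u) by ring,
        Nat.add_mul_div_left _ _ hp.pos, add_comm]
    rw [h1, h2, h3, Nat.choose_zero_right, one_mul]
    exact ih _ (Nat.div_lt_of_lt_mul (by rwa [pow_succ, mul_comm] at hs))

/-- If `p` divides `choose (m + r - 1) r` for `1 ≤ r < R`, then `m` is divisible by a power of `p`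
which is at least `R`. -/
lemma le_of_dvd_choose (p : ℕ) [Fact p.Prime] {m R : ℕ} (hm : 1 ≤ m)
    (h : ∀ r, 1 ≤ r → r < R → p ∣ (m + r - 1).choose r) : R ≤ m := by
  have hp := (Fact.out : p.Prime)
  obtain ⟨e, u, hu, rfl⟩ := Nat.exists_eq_pow_mul_and_not_dvd (n := m) (by omega) p hp.ne_one
  have hpe : 0 < p ^ e := pow_pos hp.pos e
  have hu0 : 0 < u := Nat.pos_of_ne_zero fun h0 => hu (h0 ▸ dvd_zero p)
  by_contra hlt
  push Not at hlt
  -- With `m = p ^ e * u` and `p ∤ u`, the value `r = p ^ e` gives a binomial coefficient congruent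
  -- to `u`.
  have h1 := h (p ^ e) hpe (lt_of_le_of_lt (Nat.le_mul_of_pos_right _ hu0) hlt)
  rw [show p ^ e * u + p ^ e - 1 = p ^ e * u + (p ^ e - 1) by omega] at h1
  exact hu ((choose_prime_pow_modEq p e u _ (by omega)).dvd_iff dvd_rfl |>.mp h1)

/-! ### Centralizer sequences -/

section CentralizerSequence

variable {K : Type*} [Field K]

/-- The identities satisfied by the sequence `f` of scalars which describes the action of an element
`y` of `C_2` in an algebra of maximal class. -/
structure IsCentralizerSequence (f : ℕ → K) : Prop where
  one : f 1 = 0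
  two : f 2 = 0
  rel : ∀ i j, 1 ≤ i →
    diff f j i * (f (i + j + 1) - f (j + 1)) = diff f j (i + 1) * (f i - f (j + 1))
  antisymm : ∀ i j, diff f j (i + 1) = -diff f i (j + 1)

/-- The first nonzero term of the sequence `f` is the one with index `n`. -/
def FirstNonzero (f : ℕ → K) (n : ℕ) : Prop :=
  1 ≤ n ∧ f n ≠ 0 ∧ ∀ k, 1 ≤ k → k < n → f k = 0

lemma exists_firstNonzero {f : ℕ → K} {k : ℕ} (hk : 1 ≤ k) (h : f k ≠ 0) :
    ∃ n, FirstNonzero f n := by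
  classical
  have hex : ∃ k, 1 ≤ k ∧ f k ≠ 0 := ⟨k, hk, h⟩
  refine ⟨Nat.find hex, (Nat.find_spec hex).1, (Nat.find_spec hex).2, fun m hm hlt => ?_⟩
  by_contra hne
  exact Nat.find_min hex hlt ⟨hm, hne⟩

lemma exists_last_before {P : ℕ → Prop} {a b : ℕ} (hab : a < b) (ha : P a) :
    ∃ c, a ≤ c ∧ c < b ∧ P c ∧ ∀ k, c < k → k < b → ¬ P k := by
  classical
  refine ⟨Nat.findGreatest P (b - 1), Nat.le_findGreatest (by omega) ha, ?_,
    Nat.findGreatest_spec (m := a) (by omega) ha, fun k hk hkb =>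
      Nat.findGreatest_is_greatest hk (by omega)⟩
  have := Nat.findGreatest_le (P := P) (b - 1)
  omega

/-! ### Gaps between nonzero terms, and the parameter as a power of `p`. -/

namespace IsCentralizerSequence

variable {f : ℕ → K} {p q : ℕ}

/-- If `n = 2j + 1`, antisymmetry on the diagonal kills the difference of order `j` at `j + 1`,
whose window ends at `n` and meets no other nonzero term. -/
lemma exists_first_eq_two_mul (hf : IsCentralizerSequence f) (h2 : (2 : K) ≠ 0) {n : ℕ}
    (hn : FirstNonzero f n) : ∃ q, 2 ≤ q ∧ n = 2 * q := by
  obtain ⟨h1, hne, hz⟩ := hn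
  have hn1 : n ≠ 1 := fun h => hne (h ▸ hf.one)
  have hn2 : n ≠ 2 := fun h => hne (h ▸ hf.two)
  rcases Nat.even_or_odd' n with ⟨j, hj | hj⟩
  · exact ⟨j, by omega, hj⟩
  · exfalso
    have h3 := hf.antisymm j j
    have h4 : diff f j (j + 1) = 0 := by
      have : (2 : K) * diff f j (j + 1) = 0 := by linear_combination h3
      exact (mul_eq_zero.mp this).resolve_left h2
    rw [diff_eq_last fun k hk => hz _ (by omega) (by omega)] at h4
    refine hne ?_
    rw [hj, show 2 * j + 1 = j + 1 + j by ring]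
    exact (mul_eq_zero.mp h4).resolve_left (pow_ne_zero _ (neg_ne_zero.mpr one_ne_zero))

/-- If `2q` zeros followed `a`, then `rel` at `i = a`, `j = 2q - 1` would read `f a * (-f (2q)) =
0`. -/
lemma exists_next (hf : IsCentralizerSequence f) (hq : FirstNonzero f (2 * q)) {a : ℕ}
    (ha : 1 ≤ a) (hfa : f a ≠ 0) : ∃ m, 1 ≤ m ∧ m ≤ 2 * q ∧ f (a + m) ≠ 0 ∧
      ∀ k, 1 ≤ k → k < m → f (a + k) = 0 := by
  classical
  have hex : ∃ m, 1 ≤ m ∧ m ≤ 2 * q ∧ f (a + m) ≠ 0 := by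
    by_contra hno
    push Not at hno
    have hq1 := hq.1
    have h := hf.rel a (2 * q - 1) ha
    rw [diff_eq_first fun k hk hk1 => hno k hk1 (by omega),
      diff_eq_zero fun k hk => by
        rw [show a + 1 + k = a + (k + 1) by ring]; exact hno (k + 1) (by omega) (by omega),
      show a + (2 * q - 1) + 1 = a + 2 * q by omega, hno _ hq1 le_rfl,
      show 2 * q - 1 + 1 = 2 * q by omega, zero_mul, zero_sub] at h
    exact (mul_ne_zero hfa (neg_ne_zero.mpr hq.2.1)) h
  obtain ⟨h1, h2, h3⟩ := Nat.find_spec hex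
  refine ⟨Nat.find hex, h1, h2, h3, fun k hk hlt => ?_⟩
  by_contra hne
  exact Nat.find_min hex hlt ⟨hk, by omega, hne⟩

/-- In `rel` at `i = a - r`, `j = m + r - 1` the right side vanishes, and the window on the left
contains only `f a`, in position `r`. -/
lemma dvd_choose (hf : IsCentralizerSequence f) [CharP K p]
    (hq : FirstNonzero f (2 * q)) {a m r : ℕ} (hm : 1 ≤ m) (hr : 1 ≤ r) (hra : r < a)
    (hmr : m + r < 2 * q) (hfa : f a ≠ 0) (hfam : f (a + m) ≠ 0)
    (hmid : ∀ k, 1 ≤ k → k < m → f (a + k) = 0) (hprev : ∀ k, 1 ≤ k → k ≤ r → f (a - k) = 0) :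
    p ∣ (m + r - 1).choose r := by
  have h := hf.rel (a - r) (m + r - 1) (by omega)
  rw [hprev r hr le_rfl, show m + r - 1 + 1 = m + r by omega, hq.2.2 _ (by omega) hmr,
    show a - r + (m + r - 1) + 1 = a + m by omega, sub_zero, sub_zero, mul_zero] at h
  have h1 := (mul_eq_zero.mp h).resolve_right hfam
  rw [diff_eq_single (r := r) (by omega), show a - r + r = a by omega] at h1
  · have h2 := (mul_eq_zero.mp h1).resolve_right hfa
    have h3 := (mul_eq_zero.mp h2).resolve_left (pow_ne_zero _ (neg_ne_zero.mpr one_ne_zero))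
    exact (CharP.cast_eq_zero_iff K p _).mp h3
  · intro k hk hkr
    rcases lt_or_gt_of_ne hkr with hlt | hgt
    · rw [show a - r + k = a - (r - k) by omega]
      exact hprev _ (by omega) (by omega)
    · rw [show a - r + k = a + (k - r) by omega]
      exact hmid _ (by omega) (by omega)

/-- Everything before `2q` is zero, so `dvd_choose` applies for all `r < 2q - m`; this gives `2q - m
≤ m`. -/
lemma le_second_gap (hf : IsCentralizerSequence f) [Fact p.Prime] [CharP K p]
    (hq : FirstNonzero f (2 * q)) {m : ℕ} (hm : 1 ≤ m)
    (hfm : f (2 * q + m) ≠ 0) (hmid : ∀ k, 1 ≤ k → k < m → f (2 * q + k) = 0) : q ≤ m := by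
  have := le_of_dvd_choose p (R := 2 * q - m) hm fun r hr hlt =>
    hf.dvd_choose hq hm hr (by omega) (by omega) hq.2.1 hfm hmid fun k hk hkr =>
      hq.2.2 _ (by omega) (by omega)
  omega

/-- Let `q = p ^ e * u` with `p ∤ u` and `p ^ e = 2t + 1 < q`. The diagonal difference of order `q +
t` starts at `q + t + 1` and ends at `2q + p ^ e`, before the next nonzero term. It therefore sees
only `f (2q)`, with coefficient `± choose (q + t) (p ^ e) ≡ ± u`, which must vanish. -/
lemma exists_eq_prime_pow (hf : IsCentralizerSequence f) [hp : Fact p.Prime] [CharP K p]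
    (hp2 : p ≠ 2) (hq2 : 2 ≤ q) (hq : FirstNonzero f (2 * q)) :
    ∃ h, 1 ≤ h ∧ q = p ^ h := by
  have h2 : (2 : K) ≠ 0 := Ring.two_ne_zero (by rwa [ringChar.eq K p])
  obtain ⟨m, hm1, -, hfm, hmid⟩ := hf.exists_next hq (by omega) hq.2.1
  have hqm := hf.le_second_gap (p := p) hq hm1 hfm hmid
  obtain ⟨e, u, hu, hqu⟩ := Nat.exists_eq_pow_mul_and_not_dvd (n := q) (by omega) p hp.out.ne_one
  have hpe : 0 < p ^ e := pow_pos hp.out.pos e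
  have hu0 : 0 < u := Nat.pos_of_ne_zero fun h0 => hu (h0 ▸ dvd_zero p)
  have hle : p ^ e ≤ q := hqu ▸ Nat.le_mul_of_pos_right _ hu0
  rcases hle.eq_or_lt with heq | hlt
  · refine ⟨e, Nat.one_le_iff_ne_zero.mpr ?_, heq.symm⟩
    rintro rfl
    simp at heq
    omega
  · exfalso
    obtain ⟨t, ht⟩ : Odd (p ^ e) := (hp.out.odd_of_ne_two hp2).pow
    have h3 := hf.antisymm (q + t) (q + t)
    have h4 : diff f (q + t) (q + t + 1) = 0 := by
      have : (2 : K) * diff f (q + t) (q + t + 1) = 0 := by linear_combination h3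
      exact (mul_eq_zero.mp this).resolve_left h2
    rw [diff_eq_single (r := q - t - 1) (by omega),
      show q + t + 1 + (q - t - 1) = 2 * q by omega] at h4
    · have h5 := (mul_eq_zero.mp h4).resolve_right hq.2.1
      have h6 := (mul_eq_zero.mp h5).resolve_left (pow_ne_zero _ (neg_ne_zero.mpr one_ne_zero))
      have h7 := (CharP.cast_eq_zero_iff K p _).mp h6
      rw [← Nat.choose_symm_of_eq_add (show q + t = p ^ e + (q - t - 1) by omega)] at h7
      have h8 := choose_prime_pow_modEq p e u t (by omega)
      rw [← hqu] at h8
      exact hu ((h8.dvd_iff dvd_rfl).mp h7)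
    · intro k hk hkr
      rcases lt_or_gt_of_ne hkr with hlt' | hgt
      · exact hq.2.2 _ (by omega) (by omega)
      · rw [show q + t + 1 + k = 2 * q + (k - (q - t - 1)) by omega]
        exact hmid _ (by omega) (by omega)

/-- Induction on the right endpoint `b`. If `c` is the last nonzero index before `b`, the gaps
ending at `c` are already at least `q`, so `dvd_choose` is available at `c` for all shifts below
`q`. -/
lemma le_gap (hf : IsCentralizerSequence f) [Fact p.Prime] [CharP K p]
    (hq : FirstNonzero f (2 * q)) {a r : ℕ} (ha : 1 ≤ a) (hfa : f a ≠ 0) (hr : 1 ≤ r)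
    (hfar : f (a + r) ≠ 0) : q ≤ r := by
  obtain ⟨b, hb⟩ : ∃ b, b = a + r := ⟨_, rfl⟩
  induction b using Nat.strong_induction_on generalizing a r with
  | _ b ih =>
    obtain ⟨c, hac, hcb, hfc, hlast⟩ :=
      exists_last_before (P := fun k => f k ≠ 0) (show a < b by omega) hfa
    have hc : 2 * q ≤ c := by
      by_contra hlt
      exact hfc (hq.2.2 c (by omega) (by omega))
    by_contra hrq
    obtain ⟨m, hm⟩ : ∃ m, b = c + m := ⟨b - c, by omega⟩
    have := le_of_dvd_choose p (m := m) (R := q) (by omega) fun s hs hsq =>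
      hf.dvd_choose hq (a := c) (by omega) hs (by omega) (by omega) hfc
        (by rw [← hm, hb]; exact hfar)
        (fun k hk hkm => not_not.mp (hlast _ (by omega) (by omega)))
        (fun k hk hks => by
          by_contra hne
          have := ih c (by omega) (a := c - k) (r := k) (by omega) hne hk
            (by rwa [show c - k + k = c by omega]) (by omega)
          omega)
    omega

/-! ### Block sums, and divisibility of the nonzero indices by `q`. -/

/-- The relation `rel` for differences of block sums. -/
lemma rel_block (hf : IsCentralizerSequence f) [Fact p.Prime] [CharP K p] (h n i : ℕ)
    (hi : 1 ≤ i) :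
    diff (fun l => blockSum f (p ^ h) (i + p ^ h * l)) n 0 *
        (f (i + p ^ h * (n + 1)) - f (p ^ h * (n + 1))) =
      diff (fun l => blockSum f (p ^ h) (i + 1 + p ^ h * l)) n 0 *
        (f i - f (p ^ h * (n + 1))) := by
  have hpos : 0 < p ^ h * (n + 1) := Nat.mul_pos (pow_pos (Fact.out : p.Prime).pos h) n.succ_pos
  have := hf.rel i (p ^ h * (n + 1) - 1) hi
  rwa [diff_block, diff_block, add_assoc, Nat.sub_add_cancel hpos] at this

lemma antisymm_block (hf : IsCentralizerSequence f) [Fact p.Prime] [CharP K p] (h n n' : ℕ) :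
    diff (fun l => blockSum f (p ^ h) (p ^ h * (n' + 1) + p ^ h * l)) n 0 =
      -diff (fun l => blockSum f (p ^ h) (p ^ h * (n + 1) + p ^ h * l)) n' 0 := by
  have hpos : ∀ n, 0 < p ^ h * (n + 1) := fun n =>
    Nat.mul_pos (pow_pos (Fact.out : p.Prime).pos h) n.succ_pos
  have := hf.antisymm (p ^ h * (n' + 1) - 1) (p ^ h * (n + 1) - 1)
  rwa [diff_block, diff_block, Nat.sub_add_cancel (hpos n), Nat.sub_add_cancel (hpos n')] at this

lemma diff_block_one (hf : IsCentralizerSequence f) [Fact p.Prime] [CharP K p] (h n : ℕ) :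
    diff (fun l => blockSum f (p ^ h) (1 + p ^ h * l)) n 0 = -f (p ^ h * (n + 1)) := by
  have hpos : 0 < p ^ h * (n + 1) := Nat.mul_pos (pow_pos (Fact.out : p.Prime).pos h) n.succ_pos
  have := hf.antisymm 0 (p ^ h * (n + 1) - 1)
  rwa [diff_block, diff_zero, Nat.sub_add_cancel hpos, zero_add] at this

/-- Moving a block by one place changes only its two ends. Combined with `rel_block`, this gives two
linear equations for the block differences at `i` and at `i + 1`. -/
lemma diff_block_sub (q n i : ℕ) :
    diff (fun l => blockSum f q (i + q * l)) n 0 -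
        diff (fun l => blockSum f q (i + 1 + q * l)) n 0 =
      diff (fun l => f (i + q * l) - f (i + q * (l + 1))) n 0 := by
  rw [← diff_sub]
  refine diff_congr fun l _ => ?_
  simp only [zero_add]
  rw [show i + 1 + q * l = i + q * l + 1 by ring, blockSum_succ,
    show i + q * (l + 1) = i + q * l + q by ring]
  abel

/-- If a term different from `0` and `f (2q)` occurs first at `b`, then the nonzero terms before it
have indices congruent to `b` modulo `q`. -/
lemma modEq_of_exceptional (hf : IsCentralizerSequence f) [Fact p.Prime] [CharP K p] {h : ℕ}
    (hq : FirstNonzero f (2 * p ^ h)) {b : ℕ} (hb : f b ≠ 0) (hbμ : f b ≠ f (2 * p ^ h))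
    (hmin : ∀ k, 1 ≤ k → k < b → f k ≠ 0 → f k = f (2 * p ^ h))
    {a : ℕ} (ha : 1 ≤ a) (hab : a < b) (hfa : f a ≠ 0) : a ≡ b [MOD p ^ h] := by
  set q := p ^ h with hqdef
  have hqpos : 0 < q := pow_pos (Fact.out : p.Prime).pos h
  by_contra hmod
  -- Take the last offending index `c`. After it, every nonzero term before `b` is congruent to `b`.
  obtain ⟨c, hac, hcb, ⟨hfc, hcmod⟩, hlast⟩ := exists_last_before
    (P := fun k => f k ≠ 0 ∧ ¬ k ≡ b [MOD q]) hab ⟨hfa, hmod⟩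
  have hc2 : 2 * q ≤ c := by
    by_contra hlt
    exact hfc (hq.2.2 c (by omega) (by omega))
  have hμ := hmin c (by omega) hcb hfc
  obtain ⟨d, hd⟩ : ∃ d, b = c + d := ⟨b - c, by omega⟩
  have hdmod : ¬ q ∣ d := fun hdvd => hcmod ((Nat.modEq_iff_dvd' hcb.le).mpr (by
    rwa [hd, Nat.add_sub_cancel_left]))
  set M := d / q with hM
  have hdM : q * M + d % q = d := Nat.div_add_mod d q
  have hdlt : d % q < q := Nat.mod_lt _ hqpos
  have hdpos : 0 < d % q := Nat.pos_of_ne_zero fun h0 => hdmod (Nat.dvd_of_mod_eq_zero h0)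
  -- The class of `c` modulo `q` carries no nonzero term after `c` up to `c + q * (M + 1)`: before
  -- `b` by the choice of `c`, and beyond `b` because that index is closer than `q` to `b`.
  have hzero : ∀ N, 1 ≤ N → N ≤ M + 1 → f (c + q * N) = 0 := by
    intro N hN hNM
    by_contra hne
    have hle : q * N ≤ q * M + q := by
      calc q * N ≤ q * (M + 1) := Nat.mul_le_mul_left q hNM
        _ = q * M + q := by ring
    have hge : q ≤ q * N := Nat.le_mul_of_pos_right q hN
    have hncong : ¬ (c + q * N ≡ b [MOD q]) := fun h' => hcmod (by
      have h1 : c + q * N ≡ c [MOD q] := by simp [Nat.ModEq]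
      exact h1.symm.trans h')
    rcases lt_trichotomy (c + q * N) b with hlt | heq | hgt
    · exact hlast _ (by omega) hlt ⟨hne, hncong⟩
    · exact hncong (heq ▸ Nat.ModEq.refl _)
    · have := hf.le_gap (p := p) hq (a := b) (r := c + q * N - b) (by omega) hb (by omega)
        (by rwa [show b + (c + q * N - b) = c + q * N by omega])
      omega
  -- The two linear equations at `i = c` give the value `-f (q * (n + 1))`, which antisymmetry also
  -- gives for the blocks starting at `1`.
  have hdiff : ∀ n ≤ M, diff (fun l => blockSum f q (c + 1 + q * l)) n 0 =
      diff (fun l => blockSum f q (1 + q * l)) n 0 := by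
    intro n hn
    have h0 : diff (fun l => f (c + q * l) - f (c + q * (l + 1))) n 0 = _ :=
      diff_eq_first fun l hl hl1 => by
        simp only [zero_add]
        rw [hzero l hl1 (by omega), hzero (l + 1) (by omega) (by omega), sub_zero]
    have h1 := diff_block_sub (f := f) q n c
    rw [h0, mul_zero, add_zero, zero_add, hzero 1 le_rfl (by omega), sub_zero] at h1
    have h2 := hf.rel_block (p := p) h n c (by omega)
    rw [← hqdef, hzero (n + 1) (by omega) (by omega)] at h2
    rw [hqdef, hf.diff_block_one, ← hqdef]
    refine mul_right_cancel₀ hfc ?_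
    linear_combination -h2 - f (q * (n + 1)) * h1
  -- Hence the block sums themselves agree. The `M`-th block after `c` contains only `b`, while the
  -- `M`-th block from `1` lies before `b` and sums to `0` or `f (2q)`.
  have hS := eq_of_diff_eq hdiff M le_rfl
  have hqM : q * M + q < b := by omega
  rw [blockSum_eq_single (r := d % q - 1) (by omega),
    show c + 1 + q * M + (d % q - 1) = b by omega] at hS
  · by_cases hall : ∀ k < q, f (1 + q * M + k) = 0
    · exact hb (hS.trans (blockSum_eq_zero hall))
    · push Not at hall
      obtain ⟨k, hk, hfk⟩ := hall
      rw [blockSum_eq_single hk] at hS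
      · exact hbμ (hS.trans (hmin _ (by omega) (by omega) hfk))
      · intro l hl hlk
        by_contra hne
        rcases lt_or_gt_of_ne hlk with hlt | hgt
        · have := hf.le_gap (p := p) hq (a := 1 + q * M + l) (r := k - l) (by omega) hne (by omega)
            (by rwa [show 1 + q * M + l + (k - l) = 1 + q * M + k by omega])
          omega
        · have := hf.le_gap (p := p) hq (a := 1 + q * M + k) (r := l - k) (by omega) hfk (by omega)
            (by rwa [show 1 + q * M + k + (l - k) = 1 + q * M + l by omega])
          omega
  · intro k hk hkr
    by_contra hne
    rcases lt_or_gt_of_ne (show c + 1 + q * M + k ≠ b by omega) with hlt | hgt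
    · have := hf.le_gap (p := p) hq (a := c + 1 + q * M + k) (r := b - (c + 1 + q * M + k))
        (by omega) hne (by omega)
        (by rwa [show c + 1 + q * M + k + (b - (c + 1 + q * M + k)) = b by omega])
      omega
    · have := hf.le_gap (p := p) hq (a := b) (r := c + 1 + q * M + k - b)
        (by omega) hb (by omega)
        (by rwa [show b + (c + 1 + q * M + k - b) = c + 1 + q * M + k by omega])
      omega

/-- If `f c'` is the first nonzero term whose index is not a multiple of `q`, then the terms before
it take the values `0` and `f c'` only. -/
lemma eq_zero_or_eq_of_not_dvd (hf : IsCentralizerSequence f) [Fact p.Prime] [CharP K p] {h : ℕ}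
    (h2 : 2 ≤ p ^ h) (hq : FirstNonzero f (2 * p ^ h)) {c' : ℕ} (hc'1 : 1 ≤ c') (hfc' : f c' ≠ 0)
    (hc'dvd : ¬ p ^ h ∣ c') (hmin : ∀ k, 1 ≤ k → k < c' → f k ≠ 0 → p ^ h ∣ k) {n : ℕ}
    (hn : p ^ h * (n + 1) < c') :
    f (p ^ h * (n + 1)) = 0 ∨ f (p ^ h * (n + 1)) = f c' := by
  set q := p ^ h with hqdef
  have hc'2 : 2 * q < c' := by
    rcases lt_trichotomy (2 * q) c' with hlt | heq | hgt
    · exact hlt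
    · exact absurd (heq ▸ Dvd.intro_left 2 rfl) hc'dvd
    · exact absurd (hq.2.2 c' hc'1 hgt) hfc'
  obtain ⟨c, hc2, hcc', hfc, hlast⟩ :=
    exists_last_before (P := fun k => f k ≠ 0) hc'2 hq.2.1
  obtain ⟨γ, hγ⟩ := hmin c (by omega) hcc' hfc
  have hgap1 : q ≤ c' - c := hf.le_gap (p := p) hq (a := c) (by omega) hfc (by omega)
    (by rwa [show c + (c' - c) = c' by omega])
  have hgap2 : c' - c ≤ 2 * q := by
    obtain ⟨m, hm1, hm2, hfm, -⟩ := hf.exists_next hq (by omega) hfc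
    by_contra hlt
    exact hlast (c + m) (by omega) (by omega) hfm
  -- Thus `c'` lies strictly between `c + q` and `c + 2q`.
  have hne1 : c' ≠ c + q := fun heq => hc'dvd (heq ▸ hγ ▸ ⟨γ + 1, by ring⟩)
  have hne2 : c' ≠ c + 2 * q := fun heq => hc'dvd (heq ▸ hγ ▸ ⟨γ + 2, by ring⟩)
  have hz : ∀ k, 1 ≤ k → k < c' → ¬ q ∣ k → f k = 0 := fun k hk hkc hkd => by
    by_contra hne; exact hkd (hmin k hk hkc hne)
  have hnear : ∀ k, k ≠ c' → c' < k + q → k < c' + q → 1 ≤ k → f k = 0 := fun k hk h1 h3 hk1 => by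
    by_contra hne
    rcases lt_or_gt_of_ne hk with hlt | hgt
    · have := hf.le_gap (p := p) hq (a := k) (r := c' - k) hk1 hne (by omega)
        (by rwa [show k + (c' - k) = c' by omega])
      omega
    · have := hf.le_gap (p := p) hq (a := c') (r := k - c') hc'1 hfc' (by omega)
        (by rwa [show c' + (k - c') = k by omega])
      omega
  have hnd : ∀ k l, k + q * l = c' → ¬ q ∣ k := fun k l hkl hd =>
    hc'dvd (hkl ▸ (Nat.dvd_add hd (Dvd.intro l rfl)))
  have hsign : ∀ n, ((-1 : K) ^ n) * (-1) ^ n = 1 := fun n => by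
    rw [← mul_pow]; simp
  -- the values of the block differences ending just before `c'`
  have hA : ∀ n ≤ γ, ∃ i, 1 ≤ i ∧ i + q * (n + 1) = c' ∧
      diff (fun l => blockSum f q (i + q * l)) n 0 = (-1) ^ (n + 1) * f (q * (n + 1)) := by
    intro n hn
    have hle : q * (n + 1) ≤ c + q := by
      rw [hγ, mul_add, mul_one]; exact Nat.add_le_add_right (Nat.mul_le_mul_left q hn) q
    obtain ⟨i, hi⟩ : ∃ i, i + q * (n + 1) = c' := ⟨c' - q * (n + 1), by omega⟩
    refine ⟨i, by omega, hi, ?_⟩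
    have hzi : ∀ l ≤ n, f (i + q * l) = 0 := fun l hl => by
      have hll : q * l + q * (n + 1 - l) = q * (n + 1) := by
        rw [← mul_add]; congr 1; omega
      have hpos : 0 < q * (n + 1 - l) := Nat.mul_pos (by omega) (by omega)
      refine hz _ (by omega) (by omega) (hnd _ (n + 1 - l) (by omega))
    have h0 : diff (fun l => f (i + q * l) - f (i + q * (l + 1))) n 0 = _ :=
      diff_eq_last fun l hl => by
        simp only [zero_add]
        rw [hzi l hl.le, hzi (l + 1) (by omega), sub_zero]
    -- Here only the last term `f c'` survives; with `rel_block`, where `f i = 0`, it determines the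
    -- difference.
    have h1 := diff_block_sub (f := f) q n i
    rw [h0, zero_add, hzi n le_rfl, hi] at h1
    have h3 := hf.rel_block (p := p) h n i (by omega)
    rw [← hqdef, hi, show f i = 0 by simpa using hzi 0 (Nat.zero_le n)] at h3
    refine mul_right_cancel₀ hfc' ?_
    rw [pow_succ]
    linear_combination h3 + f (q * (n + 1)) * h1
  -- Now align the blocks with multiples of `q`. For `l < n` the aligned and unaligned blocks
  -- contain the same multiple of `q`, their only possible nonzero term. For `l = n` the unaligned
  -- block, starting after `c` and ending before `c'`, is zero, and the aligned one contains `c'`.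
  have hB : ∀ n ≤ γ, diff (fun l => blockSum f q (q * (γ - n + 1) + q * l)) n 0 =
      (-1) ^ (n + 1) * (f (q * (n + 1)) - f c') := by
    intro n hn
    obtain ⟨i, hi1, hi, hAi⟩ := hA n hn
    have hi' : q * (γ - n + 1) + q * (n + 1) = c + 2 * q := by
      rw [hγ, ← mul_add, show γ - n + 1 + (n + 1) = γ + 2 by omega]; ring
    have hsub := diff_sub (fun l => blockSum f q (q * (γ - n + 1) + q * l))
      (fun l => blockSum f q (i + q * l)) n 0
    have hexp : q * (n + 1) = q * n + q := by ring
    rw [diff_eq_last] at hsub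
    · simp only [zero_add] at hsub
      rw [blockSum_eq_single (r := c' - (c + q)) (by omega), blockSum_eq_zero,
        show q * (γ - n + 1) + q * n + (c' - (c + q)) = c' by omega, hAi] at hsub
      · rw [pow_succ] at hsub ⊢
        linear_combination -hsub
      · intro k hk
        exact not_not.mp (hlast _ (by omega) (by omega))
      · intro k hk hkr
        exact hnear _ (by omega) (by omega) (by omega) (by omega)
    · intro l hl
      have hlq : q * l + q ≤ q * n := by
        calc q * l + q = q * (l + 1) := by ring
          _ ≤ q * n := Nat.mul_le_mul_left q hl
      have hdv : ∀ k, 0 < k → k < q → ¬ q ∣ q * (γ - n + 1) + q * l + k := fun k hk hkq hd => by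
        have h3 : q ∣ k := (Nat.dvd_add_right (⟨γ - n + 1 + l, by ring⟩)).mp hd
        exact absurd (Nat.le_of_dvd hk h3) (by omega)
      have hdv' : ∀ k, 0 < k → k < q → k ≤ q * (γ - n + 1) + q * l →
          ¬ q ∣ q * (γ - n + 1) + q * l - k := fun k hk hkq hkl hd => by
        have h3 : q ∣ k := by
          have := Nat.dvd_sub (show q ∣ q * (γ - n + 1) + q * l from ⟨γ - n + 1 + l, by ring⟩) hd
          rwa [show q * (γ - n + 1) + q * l - (q * (γ - n + 1) + q * l - k) = k by omega] at this
        exact absurd (Nat.le_of_dvd hk h3) (by omega)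
      simp only [zero_add]
      rw [blockSum_eq_single (r := 0) (by omega), blockSum_eq_single (r := c + 2 * q - c')
        (by omega), show i + q * l + (c + 2 * q - c') = q * (γ - n + 1) + q * l by omega, add_zero,
        sub_self]
      · intro k hk hkr
        refine hz _ (by omega) (by omega) ?_
        rcases lt_or_gt_of_ne hkr with hlt | hgt
        · rw [show i + q * l + k = q * (γ - n + 1) + q * l - (c + 2 * q - c' - k) by omega]
          exact hdv' _ (by omega) (by omega) (by omega)
        · rw [show i + q * l + k = q * (γ - n + 1) + q * l + (k - (c + 2 * q - c')) by omega]
          exact hdv _ (by omega) (by omega)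
      · intro k hk hkr
        exact hz _ (by omega) (by omega) (hdv k (by omega) hk)
  have hanti : ∀ n ≤ γ, (-1 : K) ^ (n + 1) * (f (q * (n + 1)) - f c') =
      -((-1) ^ (γ - n + 1) * (f (q * (γ - n + 1)) - f c')) := by
    intro n hn
    have h1 := hf.antisymm_block (p := p) h n (γ - n)
    have h3 := hB (γ - n) (Nat.sub_le _ _)
    rw [show γ - (γ - n) = n by omega] at h3
    rwa [← hqdef, hB n hn, h3] at h1
  -- At `n = 0` both `f q` and `f (c + q)` vanish, leaving a sign condition on `γ`; this makes the
  -- values at multiples of `q` symmetric.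
  have hsgn : (-1 : K) ^ γ = -1 := by
    have h1 := hanti 0 (Nat.zero_le _)
    rw [Nat.sub_zero, show q * (γ + 1) = c + q by rw [hγ]; ring,
      not_not.mp (hlast (c + q) (by omega) (by omega)), show q * (0 + 1) = q by ring,
      hq.2.2 q (by omega) (by omega), pow_succ] at h1
    refine mul_right_cancel₀ hfc' ?_
    linear_combination h1
  have hpal : ∀ n ≤ γ, f (q * (γ - n + 1)) = f (q * (n + 1)) := by
    intro n hn
    have h1 := hanti n hn
    have h3 : (-1 : K) ^ (γ - n) * (-1) ^ n = -1 := by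
      rw [← pow_add, show γ - n + n = γ by omega, hsgn]
    rw [pow_succ, pow_succ] at h1
    have h4 := hsign n
    linear_combination (-1 : K) ^ n * h1 + (f (q * (n + 1)) - f c') * h4 +
      (f (q * (γ - n + 1)) - f c') * h3
  have hnγ : n ≤ γ := by
    by_contra hlt
    have : q * (γ + 2) ≤ q * (n + 1) := Nat.mul_le_mul_left q (by omega)
    have : q * (γ + 2) = c + 2 * q := by rw [hγ]; ring
    omega
  have hpos : 0 < q * (γ - n + 1) := Nat.mul_pos (by omega) (by omega)
  -- By the symmetry the right side is zero, and `f (c + 2q) = 0` because of `c'`; what remains is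
  -- `(f (q(n+1)) - f c') * f (q(n+1)) = 0` up to sign.
  have h1 := hf.rel_block (p := p) h n (q * (γ - n + 1)) hpos
  rw [← hqdef, hB n hnγ, hpal n hnγ, sub_self, mul_zero, ← mul_add,
    show γ - n + 1 + (n + 1) = γ + 2 by omega, show q * (γ + 2) = c + 2 * q by rw [hγ]; ring,
    hnear (c + 2 * q) (by omega) (by omega) (by omega) (by omega), zero_sub] at h1
  rcases mul_eq_zero.mp h1 with h3 | h3
  · right
    exact sub_eq_zero.mp ((mul_eq_zero.mp h3).resolve_left
      (pow_ne_zero _ (neg_ne_zero.mpr one_ne_zero)))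
  · left
    exact neg_eq_zero.mp h3

/-- If at least two nonzero values occur, then the nonzero terms have indices divisible by `q`. -/
theorem dvd_of_ne_zero (hf : IsCentralizerSequence f) [Fact p.Prime] [CharP K p] {h : ℕ}
    (h2 : 2 ≤ p ^ h) (hq : FirstNonzero f (2 * p ^ h))
    (hex : ∃ b, 1 ≤ b ∧ f b ≠ 0 ∧ f b ≠ f (2 * p ^ h)) {k : ℕ} (hk : 1 ≤ k) (hfk : f k ≠ 0) :
    p ^ h ∣ k := by
  classical
  obtain ⟨hb1, hb, hbμ⟩ := Nat.find_spec hex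
  set b := Nat.find hex with hbdef
  have hmin : ∀ k, 1 ≤ k → k < b → f k ≠ 0 → f k = f (2 * p ^ h) := fun k hk hkb hfk => by
    by_contra hne
    exact Nat.find_min hex hkb ⟨hk, hfk, hne⟩
  have h2b : 2 * p ^ h < b := by
    rcases lt_trichotomy (2 * p ^ h) b with hlt | heq | hgt
    · exact hlt
    · exact absurd (heq ▸ rfl) hbμ
    · exact absurd (hq.2.2 b hb1 hgt) hb
  have hmod : ∀ a, 1 ≤ a → a < b → f a ≠ 0 → a ≡ b [MOD p ^ h] := fun a ha hab hfa =>
    hf.modEq_of_exceptional hq hb hbμ hmin ha hab hfa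
  have hbdvd : p ^ h ∣ b :=
    ((hmod _ hq.1 h2b hq.2.1).dvd_iff dvd_rfl).mp (Dvd.intro_left 2 rfl)
  by_contra hkd
  have hex' : ∃ k, 1 ≤ k ∧ f k ≠ 0 ∧ ¬ p ^ h ∣ k := ⟨k, hk, hfk, hkd⟩
  obtain ⟨hc1, hfc, hcd⟩ := Nat.find_spec hex'
  set c := Nat.find hex'
  have hcmin : ∀ k, 1 ≤ k → k < c → f k ≠ 0 → p ^ h ∣ k := fun k hk hkc hfk => by
    by_contra hne
    exact Nat.find_min hex' hkc ⟨hk, hfk, hne⟩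
  have hbc : b < c := by
    rcases lt_trichotomy b c with hlt | heq | hgt
    · exact hlt
    · exact absurd (heq ▸ hbdvd) hcd
    · exact absurd (((hmod c hc1 hgt hfc).dvd_iff dvd_rfl).mpr hbdvd) hcd
  obtain ⟨u, hu⟩ := hbdvd
  obtain ⟨n, rfl⟩ : ∃ n, u = n + 1 := Nat.exists_eq_succ_of_ne_zero (by rintro rfl; omega)
  -- Both `f b` and `f (2q)` would equal `f c`, although they differ.
  have e1 := hf.eq_zero_or_eq_of_not_dvd h2 hq hc1 hfc hcd hcmin (n := n) (hu ▸ hbc)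
  have e2 := hf.eq_zero_or_eq_of_not_dvd h2 hq hc1 hfc hcd hcmin (n := 1) (by omega)
  rw [← hu] at e1
  rw [show p ^ h * (1 + 1) = 2 * p ^ h by ring] at e2
  exact hbμ ((e1.resolve_left hb).trans (e2.resolve_left hq.2.1).symm)

/-- If at least two nonzero values occur, then the distance of two consecutive nonzero terms is `q`
or `2q`. -/
theorem gap_eq (hf : IsCentralizerSequence f) [Fact p.Prime] [CharP K p] {h : ℕ}
    (h2 : 2 ≤ p ^ h) (hq : FirstNonzero f (2 * p ^ h))
    (hex : ∃ b, 1 ≤ b ∧ f b ≠ 0 ∧ f b ≠ f (2 * p ^ h)) {a m : ℕ} (ha : 1 ≤ a) (hm : 1 ≤ m)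
    (hfa : f a ≠ 0) (hfam : f (a + m) ≠ 0) (hmid : ∀ k, 1 ≤ k → k < m → f (a + k) = 0) :
    m = p ^ h ∨ m = 2 * p ^ h := by
  have hd : p ^ h ∣ m := (Nat.dvd_add_right (hf.dvd_of_ne_zero h2 hq hex ha hfa)).mp
    (hf.dvd_of_ne_zero h2 hq hex (by omega) hfam)
  obtain ⟨m', h1, h3, h4, -⟩ := hf.exists_next hq ha hfa
  have hle : m ≤ 2 * p ^ h := by
    by_contra hlt
    exact h4 (hmid m' h1 (by omega))
  obtain ⟨u, rfl⟩ := hd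
  have hu : u ≤ 2 := by
    rw [mul_comm] at hle
    exact Nat.le_of_mul_le_mul_right hle (by omega)
  interval_cases u
  · omega
  · left; ring
  · right; ring

end IsCentralizerSequence

end CentralizerSequence

/-! ### Standard bases of algebras of maximal class -/

section StandardBasis

variable {F L : Type*} [Field F] [LieRing L] [LieAlgebra F L]

/-- A basis `x, y = v_1, v_2, …` of an algebra of maximal class with `y ∈ C_2`, such that `v_{k+1}`
is `⁅x, v_k⁆`, or `⁅y, v_k⁆` if the former is zero. -/
structure IsStandardBasis (𝒜 : ℕ → Submodule F L) (x y : L) (v : ℕ → L) : Prop where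
  linearIndependent : LinearIndependent F ![x, y]
  span_one : 𝒜 1 = Submodule.span F {x, y}
  v_one : v 1 = y
  v_ne_zero : ∀ k, 1 ≤ k → v k ≠ 0
  span : ∀ k, 2 ≤ k → 𝒜 k = Submodule.span F {v k}
  lie_y_two : ⁅y, v 2⁆ = 0
  succ : ∀ k, 1 ≤ k → v (k + 1) = ⁅x, v k⁆ ∨ ⁅x, v k⁆ = 0 ∧ v (k + 1) = ⁅y, v k⁆

namespace IsMaximalClass

variable {𝒜 : ℕ → Submodule F L} [GradedLieAlgebra 𝒜]

lemma finite_component (hL : IsMaximalClass 𝒜) (i : ℕ) : Module.Finite F (𝒜 i) := by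
  rw [← Module.rank_lt_aleph0_iff]
  match i with
  | 0 => rw [hL.zero_eq_bot, rank_bot]; exact Cardinal.aleph0_pos
  | 1 => rw [hL.rank_one]; exact Cardinal.ofNat_lt_aleph0
  | i + 2 => exact (hL.rank_le_one _ (by omega)).trans_lt Cardinal.one_lt_aleph0

/-- If `L_1` annihilated `L_k`, the sum of the `L_i` with `i ≤ k` would be stable under `L_1`, hence
under the algebra it generates. It would be a subalgebra containing `L_1`, so all of `L`, and
finite-dimensional. -/
lemma exists_lie_ne_zero (hL : IsMaximalClass 𝒜) (hinf : ¬ Module.Finite F L) {k : ℕ}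
    (hk : 1 ≤ k) : ∃ u ∈ 𝒜 1, ∃ w ∈ 𝒜 k, ⁅u, w⁆ ≠ 0 := by
  by_contra hno
  push Not at hno
  let P : Submodule F L := ⨆ i : Fin (k + 1), 𝒜 i
  have hP : ∀ i, i ≤ k → 𝒜 i ≤ P := fun i hi =>
    le_iSup (fun j : Fin (k + 1) => 𝒜 j) ⟨i, by omega⟩
  have hstab : ∀ a ∈ 𝒜 1, ∀ b ∈ P, ⁅a, b⁆ ∈ P := by
    intro a ha b hb
    induction hb using Submodule.iSup_induction' with
    | zero => simp
    | add y z _ _ hy hz => rw [lie_add]; exact add_mem hy hz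
    | mem i w hw =>
      rcases (show (i : ℕ) ≤ k by omega).eq_or_lt with heq | hlt
      · rw [hno a ha w (heq ▸ hw)]; exact zero_mem _
      · exact hP (1 + i) (by omega) (SetLike.GradedBracket.bracket_mem ha hw)
  let H : LieSubalgebra F L :=
    { carrier := {a | ∀ b ∈ P, ⁅a, b⁆ ∈ P}
      add_mem' := fun ha ha' b hb => by rw [add_lie]; exact add_mem (ha b hb) (ha' b hb)
      zero_mem' := fun b _ => by rw [zero_lie]; exact zero_mem _
      smul_mem' := fun c a ha b hb => by rw [smul_lie]; exact Submodule.smul_mem _ c (ha b hb)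
      lie_mem' := fun {a a'} ha ha' b hb => by
        rw [lie_lie]; exact sub_mem (ha _ (ha' b hb)) (ha' _ (ha b hb)) }
  have hH : H = ⊤ := top_le_iff.mp (hL.generated ▸ LieSubalgebra.lieSpan_le.mpr hstab)
  let P' : LieSubalgebra F L :=
    { P with
      lie_mem' := fun {a b} _ hb => (show a ∈ H from hH ▸ LieSubalgebra.mem_top a) b hb }
  have hP' : P' = ⊤ := top_le_iff.mp (hL.generated ▸ LieSubalgebra.lieSpan_le.mpr (hP 1 hk))
  have hPtop : P = ⊤ := eq_top_iff.mpr fun a _ =>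
    (show a ∈ P' from hP' ▸ LieSubalgebra.mem_top a)
  have hfin : ∀ i : Fin (k + 1), Module.Finite F (𝒜 i) := fun i => hL.finite_component i
  have : Module.Finite F P := Submodule.finite_iSup _
  rw [hPtop] at this
  exact hinf (Module.Finite.equiv Submodule.topEquiv)

lemma span_eq (hL : IsMaximalClass 𝒜) {k : ℕ} (hk : 2 ≤ k) {w : L} (hw : w ∈ 𝒜 k)
    (hne : w ≠ 0) : 𝒜 k = Submodule.span F {w} := by
  obtain ⟨u, -, hu⟩ := (rank_submodule_le_one_iff (𝒜 k)).mp (hL.rank_le_one k hk)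
  obtain ⟨c, rfl⟩ := Submodule.mem_span_singleton.mp (hu hw)
  have hc : c ≠ 0 := fun h => hne (by rw [h, zero_smul])
  refine le_antisymm (hu.trans ?_) ((Submodule.span_singleton_le_iff_mem _ _).mpr hw)
  rw [Submodule.span_singleton_smul_eq (isUnit_iff_ne_zero.mpr hc)]

lemma exists_isStandardBasis (hL : IsMaximalClass 𝒜) (hinf : ¬ Module.Finite F L) :
    ∃ x y v, IsStandardBasis 𝒜 x y v := by
  classical
  obtain ⟨u1, hu1, u1', hu1', hw2ne⟩ := hL.exists_lie_ne_zero hinf (k := 1) le_rfl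
  set w2 := ⁅u1, u1'⁆
  have hw2 : w2 ∈ 𝒜 2 := SetLike.GradedBracket.bracket_mem hu1 hu1'
  obtain ⟨x, hx, w2', hw2', hne⟩ := hL.exists_lie_ne_zero hinf (k := 2) (by omega)
  have hspan2 := hL.span_eq le_rfl hw2 hw2ne
  have hw3ne : ⁅x, w2⁆ ≠ 0 := by
    intro h0
    rw [hspan2] at hw2'
    obtain ⟨c, rfl⟩ := Submodule.mem_span_singleton.mp hw2'
    exact hne (by rw [lie_smul, h0, smul_zero])
  have hw3 : ⁅x, w2⁆ ∈ 𝒜 3 := SetLike.GradedBracket.bracket_mem hx hw2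
  have hspan3 := hL.span_eq (by omega) hw3 hw3ne
  have hxne : x ≠ 0 := fun h => hw3ne (by rw [h, zero_lie])
  have hfr : Module.finrank F (𝒜 1) = 2 := Module.finrank_eq_of_rank_eq hL.rank_one
  have hfin1 := hL.finite_component 1
  obtain ⟨z, hz, hzx⟩ : ∃ z ∈ 𝒜 1, z ∉ Submodule.span F {x} := by
    by_contra hno
    push Not at hno
    have h1 := Submodule.finrank_mono (show 𝒜 1 ≤ Submodule.span F {x} from hno)
    rw [hfr, finrank_span_singleton hxne] at h1
    omega
  obtain ⟨c, hc⟩ := Submodule.mem_span_singleton.mp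
    (hspan3 ▸ (SetLike.GradedBracket.bracket_mem hz hw2 : ⁅z, w2⁆ ∈ 𝒜 3))
  set y := z - c • x with hy
  have hymem : y ∈ 𝒜 1 := sub_mem hz (Submodule.smul_mem _ c hx)
  have hyx : y ∉ Submodule.span F {x} := fun h => hzx (by
    have := add_mem h (Submodule.smul_mem _ c (Submodule.mem_span_singleton_self x))
    rwa [hy, sub_add_cancel] at this)
  have hyw2 : ⁅y, w2⁆ = 0 := by rw [hy, sub_lie, smul_lie, hc, sub_self]
  have hli : LinearIndependent F ![x, y] := by
    rw [LinearIndependent.pair_iff' hxne]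
    intro a ha
    exact hyx (Submodule.mem_span_singleton.mpr ⟨a, ha⟩)
  have hspan1 : 𝒜 1 = Submodule.span F {x, y} := by
    refine (Submodule.eq_of_le_of_finrank_eq ?_ ?_).symm
    · rw [Submodule.span_le]
      rintro u (rfl | rfl)
      exacts [hx, hymem]
    · have := finrank_span_eq_card hli
      rw [Matrix.range_cons_cons_empty] at this
      rw [this, hfr]; simp
  -- The recursion starts at index `1`; `v 0 = y` is a default value.
  let v : ℕ → L := fun k =>
    Nat.rec y (fun _ u => if ⁅x, u⁆ = 0 then ⁅y, u⁆ else ⁅x, u⁆) (k - 1)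
  have hv1 : v 1 = y := rfl
  have hvs : ∀ k, 1 ≤ k → v (k + 1) = if ⁅x, v k⁆ = 0 then ⁅y, v k⁆ else ⁅x, v k⁆ := by
    intro k hk
    obtain ⟨k, rfl⟩ : ∃ l, k = l + 1 := ⟨k - 1, by omega⟩
    rfl
  have hsucc : ∀ k, 1 ≤ k → v (k + 1) = ⁅x, v k⁆ ∨ ⁅x, v k⁆ = 0 ∧ v (k + 1) = ⁅y, v k⁆ := by
    intro k hk
    rw [hvs k hk]
    split_ifs with h
    · exact Or.inr ⟨h, rfl⟩
    · exact Or.inl rfl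
  have hlie : ∀ k, 1 ≤ k → v k ∈ 𝒜 k → v k ≠ 0 → v (k + 1) ≠ 0 := by
    intro k hk hmem hne h0
    have hzero : ⁅x, v k⁆ = 0 ∧ ⁅y, v k⁆ = 0 := by
      rw [hvs k hk] at h0
      split_ifs at h0 with h
      exacts [⟨h, h0⟩, absurd h0 h]
    obtain ⟨u, hu, w, hw, huw⟩ := hL.exists_lie_ne_zero hinf hk
    have hker : ∀ u ∈ 𝒜 1, ⁅u, v k⁆ = 0 := by
      intro u hu
      rw [hspan1] at hu
      obtain ⟨α, β, rfl⟩ := Submodule.mem_span_pair.mp hu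
      rw [add_lie, smul_lie, smul_lie, hzero.1, hzero.2, smul_zero, smul_zero, add_zero]
    rcases hk.eq_or_lt with rfl | hk2
    · have hxy : ⁅x, y⁆ = 0 := hzero.1
      have hyx : ⁅y, x⁆ = 0 := by rw [← lie_skew, hxy, neg_zero]
      rw [hspan1] at hu hw
      obtain ⟨α, β, rfl⟩ := Submodule.mem_span_pair.mp hu
      obtain ⟨α', β', rfl⟩ := Submodule.mem_span_pair.mp hw
      exact huw (by simp [hxy, hyx])
    · rw [hL.span_eq hk2 hmem hne] at hw
      obtain ⟨c, rfl⟩ := Submodule.mem_span_singleton.mp hw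
      exact huw (by rw [lie_smul, hker u hu, smul_zero])
  have hv : ∀ k, 1 ≤ k → v k ∈ 𝒜 k ∧ v k ≠ 0 := by
    intro k hk
    induction k, hk using Nat.le_induction with
    | base => exact ⟨hymem, fun h => hyx (by rw [← hv1, h]; exact zero_mem _)⟩
    | succ k hk ih =>
      refine ⟨?_, hlie k hk ih.1 ih.2⟩
      rcases hsucc k hk with h | ⟨-, h⟩ <;> rw [h, add_comm]
      exacts [SetLike.GradedBracket.bracket_mem hx ih.1,
        SetLike.GradedBracket.bracket_mem hymem ih.1]
  refine ⟨x, y, v, hli, hspan1, hv1, fun k hk => (hv k hk).2, fun k hk =>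
    hL.span_eq hk (hv k (by omega)).1 (hv k (by omega)).2, ?_, hsucc⟩
  have := (hv 2 (by omega)).1
  rw [hspan2] at this
  obtain ⟨d, hd⟩ := Submodule.mem_span_singleton.mp this
  rw [← hd, lie_smul, hyw2, smul_zero]

end IsMaximalClass

namespace IsStandardBasis

variable {𝒜 : ℕ → Submodule F L} {x y : L} {v : ℕ → L}

lemma x_mem (hb : IsStandardBasis 𝒜 x y v) : x ∈ 𝒜 1 := by
  rw [hb.span_one]; exact Submodule.subset_span (by simp)

lemma y_mem (hb : IsStandardBasis 𝒜 x y v) : y ∈ 𝒜 1 := by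
  rw [hb.span_one]; exact Submodule.subset_span (by simp)

lemma v_mem (hb : IsStandardBasis 𝒜 x y v) {k : ℕ} (hk : 1 ≤ k) : v k ∈ 𝒜 k := by
  rcases hk.eq_or_lt with rfl | hk2
  · rw [hb.v_one]; exact hb.y_mem
  · rw [hb.span k hk2]; exact Submodule.mem_span_singleton_self _

lemma lie_x_of_lie_y_eq_zero (hb : IsStandardBasis 𝒜 x y v) {k : ℕ} (hk : 1 ≤ k)
    (hy : ⁅y, v k⁆ = 0) : ⁅x, v k⁆ = v (k + 1) := by
  rcases hb.succ k hk with h | ⟨-, h⟩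
  · exact h.symm
  · exact absurd (h.trans hy) (hb.v_ne_zero _ (by omega))

lemma exists_scalars [GradedLieAlgebra 𝒜] (hb : IsStandardBasis 𝒜 x y v) :
    ∃ a b : ℕ → F, ∀ k, 1 ≤ k → ⁅x, v k⁆ = a k • v (k + 1) ∧ ⁅y, v k⁆ = b k • v (k + 1) ∧
      (a k ≠ 0 ∨ b k ≠ 0) := by
  have h : ∀ k, ∃ a b : F, 1 ≤ k → ⁅x, v k⁆ = a • v (k + 1) ∧ ⁅y, v k⁆ = b • v (k + 1) ∧
      (a ≠ 0 ∨ b ≠ 0) := by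
    intro k
    by_cases hk : 1 ≤ k
    · have hmem : ∀ u ∈ 𝒜 1, ∃ c : F, c • v (k + 1) = ⁅u, v k⁆ := fun u hu => by
        have h1 : ⁅u, v k⁆ ∈ 𝒜 (1 + k) := SetLike.GradedBracket.bracket_mem hu (hb.v_mem hk)
        rw [add_comm, hb.span _ (by omega)] at h1
        exact Submodule.mem_span_singleton.mp h1
      obtain ⟨a, ha⟩ := hmem x hb.x_mem
      obtain ⟨b, hb'⟩ := hmem y hb.y_mem
      refine ⟨a, b, fun _ => ⟨ha.symm, hb'.symm, ?_⟩⟩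
      by_contra hno
      push Not at hno
      rw [hno.1, zero_smul] at ha
      rw [hno.2, zero_smul] at hb'
      rcases hb.succ k hk with h | ⟨-, h⟩
      · exact hb.v_ne_zero _ (by omega) (h.trans ha.symm)
      · exact hb.v_ne_zero _ (by omega) (h.trans hb'.symm)
    · exact ⟨0, 0, fun h => absurd h hk⟩
  choose a b hab using h
  exact ⟨a, b, hab⟩

lemma mem_twoStepCentralizer (hb : IsStandardBasis 𝒜 x y v) {k : ℕ} (hk : 2 ≤ k) {a b : F}
    (ha : ⁅x, v k⁆ = a • v (k + 1)) (hb' : ⁅y, v k⁆ = b • v (k + 1)) (α β : F) :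
    α • x + β • y ∈ twoStepCentralizer 𝒜 k ↔ α * a + β * b = 0 := by
  have hlie : ⁅v k, α • x + β • y⁆ = -((α * a + β * b) • v (k + 1)) := by
    rw [← lie_skew, add_lie, smul_lie, smul_lie, ha, hb', smul_smul, smul_smul, add_smul]
  constructor
  · intro h
    have := h.2 (v k) (hb.v_mem (by omega))
    rw [hlie, neg_eq_zero] at this
    exact (smul_eq_zero.mp this).resolve_right (hb.v_ne_zero _ (by omega))
  · intro h
    refine ⟨add_mem (Submodule.smul_mem _ _ hb.x_mem) (Submodule.smul_mem _ _ hb.y_mem), ?_⟩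
    intro w hw
    rw [hb.span k hk] at hw
    obtain ⟨c, rfl⟩ := Submodule.mem_span_singleton.mp hw
    rw [smul_lie, hlie, h, zero_smul, neg_zero, smul_zero]

lemma twoStepCentralizer_eq_iff (hb : IsStandardBasis 𝒜 x y v) {k l : ℕ} (hk : 2 ≤ k)
    (hl : 2 ≤ l) {a b a' b' : F} (h1 : ⁅x, v k⁆ = a • v (k + 1)) (h2 : ⁅y, v k⁆ = b • v (k + 1))
    (h3 : a ≠ 0 ∨ b ≠ 0) (h1' : ⁅x, v l⁆ = a' • v (l + 1)) (h2' : ⁅y, v l⁆ = b' • v (l + 1))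
    (h3' : a' ≠ 0 ∨ b' ≠ 0) :
    twoStepCentralizer 𝒜 k = twoStepCentralizer 𝒜 l ↔ a * b' = a' * b := by
  have key : ∀ {a b a' b' α β : F}, (a ≠ 0 ∨ b ≠ 0) → a * b' = a' * b → α * a + β * b = 0 →
      α * a' + β * b' = 0 := by
    intro a b a' b' α β hab h h0
    rcases hab with hne | hne
    · refine (mul_eq_zero.mp (?_ : a * (α * a' + β * b') = 0)).resolve_left hne
      linear_combination a' * h0 + β * h
    · refine (mul_eq_zero.mp (?_ : b * (α * a' + β * b') = 0)).resolve_left hne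
      linear_combination b' * h0 - α * h
  constructor
  · intro h
    have hm : b • x + (-a) • y ∈ twoStepCentralizer 𝒜 k :=
      (hb.mem_twoStepCentralizer hk h1 h2 _ _).mpr (by ring)
    rw [h, hb.mem_twoStepCentralizer hl h1' h2'] at hm
    linear_combination -hm
  · intro h
    ext u
    constructor
    · intro hu
      have hu1 := hu.1
      rw [hb.span_one] at hu1
      obtain ⟨α, β, rfl⟩ := Submodule.mem_span_pair.mp hu1
      rw [hb.mem_twoStepCentralizer hk h1 h2] at hu
      exact (hb.mem_twoStepCentralizer hl h1' h2' _ _).mpr (key h3 h hu)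
    · intro hu
      have hu1 := hu.1
      rw [hb.span_one] at hu1
      obtain ⟨α, β, rfl⟩ := Submodule.mem_span_pair.mp hu1
      rw [hb.mem_twoStepCentralizer hl h1' h2'] at hu
      exact (hb.mem_twoStepCentralizer hk h1 h2 _ _).mpr (key h3' h.symm hu)

end IsStandardBasis

end StandardBasis

/-! ### From algebras of maximal class to centralizer sequences -/

section Sequence

/-- Expanding `⁅⁅x, w (j + 1)⁆, w i⁆` by the Jacobi identity is precisely the recursion for `diff`.
-/
lemma lie_eq_diff_smul {K M : Type*} [Field K] [LieRing M] [LieAlgebra K M] {x : M} {w : ℕ → M}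
    {f : ℕ → K} (hx : ∀ k, 1 ≤ k → ⁅x, w k⁆ = w (k + 1))
    (hy : ∀ k, 1 ≤ k → ⁅w 1, w k⁆ = f k • w (k + 1)) (j i : ℕ) (hi : 1 ≤ i) :
    ⁅w (j + 1), w i⁆ = diff f j i • w (i + j + 1) := by
  induction j generalizing i with
  | zero => exact hy i hi
  | succ j ih =>
    rw [← hx (j + 1) (by omega), lie_lie, hx i hi, ih i hi, ih (i + 1) (by omega), lie_smul,
      hx _ (by omega), diff_succ, sub_smul, show i + 1 + j + 1 = i + j + 1 + 1 by ring,
      show i + (j + 1) + 1 = i + j + 1 + 1 by ring]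

/-- `rel` is the Jacobi identity for `w 1`, `w (j + 1)`, `w i`, rewritten with the recursion for
`diff`; `antisymm` compares the two orders of a bracket. -/
lemma isCentralizerSequence_of_lie {K M : Type*} [Field K] [LieRing M] [LieAlgebra K M] {x : M}
    {w : ℕ → M} {f : ℕ → K} (hne : ∀ k, 1 ≤ k → w k ≠ 0)
    (hx : ∀ k, 1 ≤ k → ⁅x, w k⁆ = w (k + 1))
    (hy : ∀ k, 1 ≤ k → ⁅w 1, w k⁆ = f k • w (k + 1)) (h2 : f 2 = 0) :
    IsCentralizerSequence f where
  one := by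
    have h := hy 1 le_rfl
    rw [lie_self] at h
    exact (smul_eq_zero.mp h.symm).resolve_right (hne _ (by omega))
  two := h2
  rel i j hi := by
    have h := lie_lie (w 1) (w (j + 1)) (w i)
    have hlie := lie_eq_diff_smul hx hy
    rw [hy _ (by omega), smul_lie, hlie (j + 1) i hi, hlie j i hi, lie_smul, hy _ (by omega),
      hy i hi, lie_smul, hlie j (i + 1) (by omega), smul_smul, smul_smul, smul_smul,
      show i + (j + 1) + 1 = i + j + 1 + 1 by ring, show i + 1 + j + 1 = i + j + 1 + 1 by ring,
      ← sub_smul] at h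
    have h' := smul_left_injective K (hne (i + j + 1 + 1) (by omega)) h
    rw [diff_succ] at h'
    linear_combination -h'
  antisymm i j := by
    have hlie := lie_eq_diff_smul hx hy
    have h := lie_skew (w (j + 1)) (w (i + 1))
    rw [hlie j (i + 1) (by omega), hlie i (j + 1) (by omega), ← neg_smul,
      show j + 1 + i + 1 = i + 1 + j + 1 by ring] at h
    exact (smul_left_injective K (hne _ (by omega)) h).symm

open RatFunc in
lemma ratFunc_add_X_mul_ne_zero {F : Type*} [Field F] {a b : F} (h : a ≠ 0 ∨ b ≠ 0) :
    (C a + X * C b : RatFunc F) ≠ 0 := by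
  intro h0
  have h1 : algebraMap F[X] (RatFunc F) (Polynomial.C a + Polynomial.X * Polynomial.C b) = 0 := by
    rw [map_add, map_mul, RatFunc.algebraMap_C, RatFunc.algebraMap_X, RatFunc.algebraMap_C]
    exact h0
  rw [map_eq_zero_iff _ (RatFunc.algebraMap_injective F)] at h1
  rcases h with h | h
  · exact h (by simpa using congrArg (Polynomial.coeff · 0) h1)
  · exact h (by simpa using congrArg (Polynomial.coeff · 1) h1)

variable {F L : Type*} [Field F] [LieRing L] [LieAlgebra F L]
  {𝒜 : ℕ → Submodule F L} {x y : L} {v : ℕ → L}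

open RatFunc in
/-- Over the field of rational functions the element `x + X y` lies outside all the two-step
centralizers. -/
lemma IsStandardBasis.isCentralizerSequence (hb : IsStandardBasis 𝒜 x y v) {a b : ℕ → F}
    (hab : ∀ k, 1 ≤ k → ⁅x, v k⁆ = a k • v (k + 1) ∧ ⁅y, v k⁆ = b k • v (k + 1) ∧
      (a k ≠ 0 ∨ b k ≠ 0)) :
    IsCentralizerSequence fun k => (C (b k) / (C (a k) + X * C (b k)) : RatFunc F) := by
  let d : ℕ → RatFunc F := fun k => C (a k) + X * C (b k)
  have hd : ∀ k, 1 ≤ k → d k ≠ 0 := fun k hk => ratFunc_add_X_mul_ne_zero (hab k hk).2.2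
  -- Since `x + X y` sends `v k` to `d k • v (k + 1)`, these products rescale `v` to a chain on
  -- which it acts as a pure shift.
  let c : ℕ → RatFunc F := fun k => ∏ i ∈ Finset.Ico 1 k, d i
  have hc : ∀ k, c k ≠ 0 := fun k => Finset.prod_ne_zero_iff.mpr fun i hi =>
    hd i (Finset.mem_Ico.mp hi).1
  have hcs : ∀ k, 1 ≤ k → c (k + 1) = c k * d k := fun k hk => Finset.prod_Ico_succ_top hk _
  let w : ℕ → RatFunc F ⊗[F] L := fun k => c k ⊗ₜ v k
  have hw1 : w 1 = 1 ⊗ₜ y := by simp [w, c, hb.v_one]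
  have hsm : ∀ (r : RatFunc F) (s : F) (u : L), r ⊗ₜ[F] (s • u) = (r * C s) ⊗ₜ[F] u :=
    fun r s u => by
      rw [TensorProduct.tmul_smul, TensorProduct.smul_tmul', mul_comm, RatFunc.smul_eq_C_mul]
  refine isCentralizerSequence_of_lie (x := 1 ⊗ₜ x + X ⊗ₜ y) (w := w) ?_ ?_ ?_ ?_
  · intro k hk h0
    have h1 : c k • ((1 : RatFunc F) ⊗ₜ[F] v k) = 0 := by
      rw [TensorProduct.smul_tmul', smul_eq_mul, mul_one]; exact h0
    have h2 := (smul_eq_zero.mp h1).resolve_left (hc k)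
    exact hb.v_ne_zero k hk
      ((map_eq_zero_iff (TensorProduct.mk F (RatFunc F) L 1)
        (Module.FaithfullyFlat.tensorProduct_mk_injective L)).mp h2)
  · intro k hk
    simp only [w]
    rw [add_lie, LieAlgebra.ExtendScalars.bracket_tmul, LieAlgebra.ExtendScalars.bracket_tmul,
      (hab k hk).1, (hab k hk).2.1, hsm, hsm, ← TensorProduct.add_tmul, hcs k hk]
    congr 1
    simp only [d]; ring
  · intro k hk
    rw [hw1]
    simp only [w]
    rw [LieAlgebra.ExtendScalars.bracket_tmul, (hab k hk).2.1, hsm, TensorProduct.smul_tmul',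
      hcs k hk]
    congr 1
    have := hd k hk
    simp only [d] at this ⊢
    rw [smul_eq_mul, mul_comm (c k) (C (a k) + _), ← mul_assoc, div_mul_cancel₀ _ this, one_mul,
      mul_comm]
  · have h2 := (hab 2 (by omega)).2.1
    rw [hb.lie_y_two] at h2
    have := (smul_eq_zero.mp h2.symm).resolve_right (hb.v_ne_zero _ (by omega))
    simp [this]

open RatFunc in
/-- If there are at least three two-step centralizers, then all constituents are short or long, and
`y` acts nontrivially only on components whose weight is a multiple of `p`. -/
theorem IsStandardBasis.constituents [GradedLieAlgebra 𝒜] (hb : IsStandardBasis 𝒜 x y v)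
    (p : ℕ) [Fact p.Prime] [CharP F p] (hp : p ≠ 2)
    (hthree : 3 ≤ (twoStepCentralizers 𝒜).encard) :
    (∃ h : ℕ, 1 ≤ h ∧ IsParameter 𝒜 (p ^ h) ∧
      ∀ a b m : ℕ, IsConstituent 𝒜 a b m → m = p ^ h ∨ m = 2 * p ^ h) ∧
    ∀ k, 1 ≤ k → ¬ p ∣ k → ⁅y, v k⁆ = 0 := by
  obtain ⟨a, b, hab⟩ := hb.exists_scalars
  have hf := hb.isCentralizerSequence hab
  set f : ℕ → RatFunc F := fun k => C (b k) / (C (a k) + X * C (b k)) with hfdef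
  have hchar : CharP (RatFunc F) p := charP_of_injective_algebraMap (algebraMap F _).injective p
  have hb2 : b 2 = 0 := by
    have h2 := (hab 2 (by omega)).2.1
    rw [hb.lie_y_two] at h2
    exact (smul_eq_zero.mp h2.symm).resolve_right (hb.v_ne_zero _ (by omega))
  have hf0 : ∀ k, 1 ≤ k → (f k = 0 ↔ b k = 0) := fun k hk => by
    simp [hfdef, ratFunc_add_X_mul_ne_zero (hab k hk).2.2]
  have hCiff : ∀ k l, 2 ≤ k → 2 ≤ l →
      (twoStepCentralizer 𝒜 k = twoStepCentralizer 𝒜 l ↔ a k * b l = a l * b k) :=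
    fun k l hk hl => hb.twoStepCentralizer_eq_iff hk hl (hab k (by omega)).1
      (hab k (by omega)).2.1 (hab k (by omega)).2.2 (hab l (by omega)).1 (hab l (by omega)).2.1
      (hab l (by omega)).2.2
  have hC2 : ∀ k, 2 ≤ k → (twoStepCentralizer 𝒜 k = twoStepCentralizer 𝒜 2 ↔ f k = 0) := by
    intro k hk
    rw [hCiff k 2 hk le_rfl, hf0 k (by omega), hb2, mul_zero, eq_comm, mul_eq_zero]
    exact or_iff_right ((hab 2 (by omega)).2.2.resolve_right (not_not.mpr hb2))
  have hCeq : ∀ k l, 2 ≤ k → 2 ≤ l → f k = f l →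
      twoStepCentralizer 𝒜 k = twoStepCentralizer 𝒜 l := by
    intro k l hk hl h
    rw [hCiff k l hk hl]
    rw [hfdef] at h
    simp only at h
    rw [div_eq_div_iff (ratFunc_add_X_mul_ne_zero (hab k (by omega)).2.2)
      (ratFunc_add_X_mul_ne_zero (hab l (by omega)).2.2)] at h
    have h' : (C (a k * b l) : RatFunc F) = C (a l * b k) := by
      rw [map_mul, map_mul]; linear_combination -h
    exact RatFunc.C_injective h'
  have hthird : ∀ D : Submodule F L, ∃ k, 2 ≤ k ∧
      twoStepCentralizer 𝒜 k ≠ twoStepCentralizer 𝒜 2 ∧ twoStepCentralizer 𝒜 k ≠ D := by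
    intro D
    by_contra hno
    push Not at hno
    have hsub : twoStepCentralizers 𝒜 ⊆ {twoStepCentralizer 𝒜 2, D} := by
      rintro _ ⟨k, hk, rfl⟩
      by_cases h : twoStepCentralizer 𝒜 k = twoStepCentralizer 𝒜 2
      · exact Or.inl h
      · exact Or.inr (hno k hk h)
    have := (hthree.trans (Set.encard_le_encard hsub)).trans (Set.encard_insert_le _ _)
    rw [Set.encard_singleton] at this
    exact absurd this (by decide)
  obtain ⟨k₀, hk₀, hne₀, -⟩ := hthird ⊥
  obtain ⟨n, hn⟩ := exists_firstNonzero (f := f) (show 1 ≤ k₀ by omega)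
    (fun h => hne₀ ((hC2 k₀ hk₀).mpr h))
  have h2 : (2 : RatFunc F) ≠ 0 := Ring.two_ne_zero (by rwa [ringChar.eq (RatFunc F) p])
  obtain ⟨q, hq2, rfl⟩ := hf.exists_first_eq_two_mul h2 hn
  obtain ⟨h, hh, rfl⟩ := hf.exists_eq_prime_pow hp hq2 hn
  obtain ⟨l, hl, hl2, hlq⟩ := hthird (twoStepCentralizer 𝒜 (2 * p ^ h))
  -- The third centralizer supplies the second nonzero value of `f`.
  have hex : ∃ b, 1 ≤ b ∧ f b ≠ 0 ∧ f b ≠ f (2 * p ^ h) :=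
    ⟨l, by omega, fun h0 => hl2 ((hC2 l hl).mpr h0), fun h0 => hlq (hCeq _ _ hl (by omega) h0)⟩
  have hsecond : SecondOccursAt 𝒜 (2 * p ^ h) :=
    ⟨by omega, fun h0 => hn.2.1 ((hC2 _ (by omega)).mp h0), fun j hj hjn =>
      (hC2 j hj).mpr (hn.2.2 j (by omega) hjn)⟩
  refine ⟨⟨h, hh, hsecond, ?_⟩, ?_⟩
  · intro s t m hc
    cases hc with
    | first _ hs =>
      right
      rcases lt_trichotomy t (2 * p ^ h) with hlt | heq | hgt
      · exact absurd (hsecond.2.2 t hs.1 hlt) hs.2.1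
      · exact heq
      · exact absurd (hs.2.2 _ hsecond.1 hgt) hsecond.2.1
    | later i _ hi hm hstart hend hmid =>
      exact hf.gap_eq hq2 hn hex (by omega) hm (fun h0 => hstart ((hC2 i hi).mpr h0))
        (fun h0 => hend ((hC2 _ (by omega)).mpr h0))
        fun k hk hkm => (hC2 _ (by omega)).mp (hmid k hk hkm)
  · intro k hk hpk
    have hbk : b k = 0 := by
      by_contra hne
      exact hpk ((dvd_pow_self p (by omega)).trans
        (hf.dvd_of_ne_zero hq2 hn hex hk fun h0 => hne ((hf0 k hk).mp h0)))
    rw [(hab k hk).2.1, hbk, zero_smul]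

end Sequence

/-! ### Truncated polynomials and extensions by derivations -/

section Trunc

variable (F : Type*) [Field F] (p : ℕ)

lemma eps_pow_eq_zero {n : ℕ} (hn : p ≤ n) : eps F p ^ n = 0 := by
  have h : eps F p ^ p = 0 := by
    rw [eps, ← map_pow, Ideal.Quotient.eq_zero_iff_mem]
    exact Ideal.mem_span_singleton_self _
  rw [← Nat.sub_add_cancel hn, pow_add, h, mul_zero]

/-- The basis `1, ε, …, ε ^ (p - 1)` of the truncated polynomial algebra. -/
lemma exists_basis_trunc :
    ∃ b : Module.Basis (Fin p) F (Trunc F p), ∀ j, b j = eps F p ^ (j : ℕ) := by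
  let B := AdjoinRoot.powerBasis' (Polynomial.monic_X_pow p : (Polynomial.X ^ p : F[X]).Monic)
  have hdim : B.dim = p := by simp [B]
  let b : Module.Basis (Fin p) F (AdjoinRoot (Polynomial.X ^ p : F[X])) :=
    B.basis.reindex (finCongr hdim)
  refine ⟨b, fun j => ?_⟩
  change B.basis.reindex (finCongr hdim) j = _
  rw [Module.Basis.reindex_apply, B.basis_eq_pow]
  rfl

variable {F p} in
lemma isUnit_inv_factorial [Fact p.Prime] [CharP F p] (j : Fin p) :
    IsUnit ((((j : ℕ).factorial : ℕ) : F)⁻¹) := by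
  rw [isUnit_iff_ne_zero]
  refine inv_ne_zero fun h => ?_
  rw [CharP.cast_eq_zero_iff F p, (Fact.out : p.Prime).dvd_factorial] at h
  omega

/-- Wilson's theorem; it is the origin of the sign in the choice `s = -δ`. -/
lemma inv_factorial_pred [Fact p.Prime] [CharP F p] :
    (((p - 1).factorial : ℕ) : F)⁻¹ = -1 := by
  have h := congrArg (ZMod.castHom dvd_rfl F) (ZMod.wilsons_lemma p)
  rw [map_natCast, map_neg, map_one] at h
  rw [h, inv_neg, inv_one]

lemma truncDerivation_eps_pow [CharP F p] (n : ℕ) :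
    truncDerivation F p (eps F p ^ n) = (n : F) • eps F p ^ (n - 1) := by
  have h : truncDerivation F p (eps F p) = 1 := by
    have := Derivation.liftOfSurjective_apply
      (Ideal.Quotient.mkₐ_surjective F (Ideal.span {(Polynomial.X : F[X]) ^ p}))
      (derivative_trunc F p) Polynomial.X
    refine this.trans ?_
    simp [Polynomial.derivative']
  rw [Derivation.leibniz_pow, h, smul_eq_mul, mul_one, Nat.cast_smul_eq_nsmul]

variable {F p} {N : Type*} [LieRing N] [LieAlgebra F N]

lemma inflationDerivation_tmul [CharP F p] (I : LieIdeal F N) (s : N) (n : ℕ) (m : I) :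
    inflationDerivation p I s ((eps F p ^ n) ⊗ₜ m) =
      (n : F) • ((eps F p ^ (n - 1)) ⊗ₜ m) + (eps F p ^ (p - 1 + n)) ⊗ₜ ⁅s, m⁆ := by
  have h : inflationDerivation p I s ((eps F p ^ n) ⊗ₜ m) =
      truncDerivation F p (eps F p ^ n) ⊗ₜ m +
        eps F p ^ (p - 1) • ((eps F p ^ n) ⊗ₜ[F] ⁅s, m⁆) := rfl
  rw [h, truncDerivation_eps_pow, TensorProduct.smul_tmul', TensorProduct.smul_tmul', smul_eq_mul,
    ← pow_add]

end Trunc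

namespace DerivExt

variable {F K : Type*} [Field F] [LieRing K] [LieAlgebra F K] (D : LieDerivation F K K)

lemma lie_inl_inl (a b : K) : ⁅inl D a, inl D b⁆ = inl D ⁅a, b⁆ := by
  ext <;> simp [inl]

lemma lie_gen_inl (a : K) : ⁅gen D, inl D a⁆ = inl D (D a) := by
  ext <;> simp [inl, gen]

/-- The ideal `K` of `K ⊕ F·D`. -/
def leftIdeal : LieIdeal F (DerivExt D) where
  carrier := {z | z.right = 0}
  add_mem' := fun {a b} ha hb => by
    change a.right + b.right = 0
    rw [show a.right = 0 from ha, show b.right = 0 from hb, add_zero]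
  zero_mem' := rfl
  smul_mem' := fun c a ha => by
    change c • a.right = 0
    rw [show a.right = 0 from ha, smul_zero]
  lie_mem := fun _ => rfl

/-- The decomposition of `K ⊕ F·D` as a vector space. -/
def prodEquiv : (K × F) ≃ₗ[F] DerivExt D where
  toFun z := ⟨z.1, z.2⟩
  invFun z := ⟨z.left, z.right⟩
  left_inv _ := rfl
  right_inv _ := rfl
  map_add' _ _ := rfl
  map_smul' _ _ := rfl

end DerivExt

/-! ### Algebras in which `C_k = C_2` unless `p` divides `k` -/

namespace IsStandardBasis

variable {F L : Type*} [Field F] [LieRing L] [LieAlgebra F L]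
  {𝒜 : ℕ → Submodule F L} {x y : L} {v : ℕ → L}

lemma exists_basis [GradedLieAlgebra 𝒜] (hL : IsMaximalClass 𝒜) (hb : IsStandardBasis 𝒜 x y v) :
    ∃ B : Module.Basis (Option ℕ) F L, B none = x ∧ ∀ k, B (some k) = v (k + 1) := by
  have hindep : iSupIndep 𝒜 := (DirectSum.Decomposition.isInternal 𝒜).submodule_iSupIndep
  have hli : LinearIndependent F fun k => v (k + 1) :=
    (hindep.comp (f := fun k => k + 1) (add_left_injective 1)).linearIndependent _
      (fun k => hb.v_mem (Nat.succ_pos k)) fun k => hb.v_ne_zero _ (by omega)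
  -- The grading cannot separate `x` from `v 1 = y`, both of weight one; projecting to that weight
  -- reduces to independence of `x` and `y`.
  have hx : x ∉ Submodule.span F (Set.range fun k => v (k + 1)) := by
    intro hx
    have hcomp : ∀ w ∈ Submodule.span F (Set.range fun k => v (k + 1)),
        (DirectSum.decompose 𝒜 w 1 : L) ∈ Submodule.span F {y} := by
      intro w hw
      induction hw using Submodule.span_induction with
      | mem w hw =>
        obtain ⟨k, rfl⟩ := hw
        by_cases hk : k = 0
        · subst hk
          simp only [zero_add]
          rw [DirectSum.decompose_of_mem_same 𝒜 (hb.v_mem le_rfl), hb.v_one]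
          exact Submodule.mem_span_singleton_self _
        · rw [DirectSum.decompose_of_mem_ne 𝒜 (hb.v_mem (k := k + 1) (by omega)) (by omega)]
          exact zero_mem _
      | zero => simp
      | add w z _ _ hw hz =>
        rw [DirectSum.decompose_add, DirectSum.add_apply, Submodule.coe_add]
        exact add_mem hw hz
      | smul c w _ hw =>
        rw [DirectSum.decompose_smul, DirectSum.smul_apply, Submodule.coe_smul]
        exact Submodule.smul_mem _ c hw
    have h1 := hcomp x hx
    rw [DirectSum.decompose_of_mem_same 𝒜 hb.x_mem] at h1
    obtain ⟨c, hc⟩ := Submodule.mem_span_singleton.mp h1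
    have h2 := LinearIndependent.pair_iff.mp hb.linearIndependent 1 (-c) (by
      rw [neg_smul, hc, one_smul, add_neg_cancel])
    exact one_ne_zero h2.1
  have hspan : ⊤ ≤ Submodule.span F
      (Set.range fun o : Option ℕ => Option.casesOn' o x fun k => v (k + 1)) := by
    rw [← (DirectSum.Decomposition.isInternal 𝒜).submodule_iSup_eq_top, iSup_le_iff]
    intro i
    match i with
    | 0 => rw [hL.zero_eq_bot]; exact bot_le
    | 1 =>
      rw [hb.span_one, Submodule.span_le]
      rintro u (rfl | rfl)
      · exact Submodule.subset_span ⟨none, rfl⟩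
      · exact Submodule.subset_span ⟨some 0, hb.v_one⟩
    | i + 2 =>
      rw [hb.span _ (by omega), Submodule.span_singleton_le_iff_mem]
      exact Submodule.subset_span ⟨some (i + 1), rfl⟩
  refine ⟨Module.Basis.mk (linearIndependent_option'.mpr ⟨hli, hx⟩) hspan, ?_, fun k => ?_⟩
  · rw [Module.Basis.mk_apply]; rfl
  · rw [Module.Basis.mk_apply]; rfl

variable {p : ℕ}

lemma lie_x_v (hb : IsStandardBasis 𝒜 x y v) (hy : ∀ k, 1 ≤ k → ¬ p ∣ k → ⁅y, v k⁆ = 0)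
    {k : ℕ} (hk : 1 ≤ k) (hpk : ¬ p ∣ k) : ⁅x, v k⁆ = v (k + 1) :=
  hb.lie_x_of_lie_y_eq_zero hk (hy k hk hpk)

lemma ad_x_pow (hb : IsStandardBasis 𝒜 x y v) (hy : ∀ k, 1 ≤ k → ¬ p ∣ k → ⁅y, v k⁆ = 0)
    {i r : ℕ} (hr : r < p) :
    (LieAlgebra.ad F L x ^ r) (v (p * i + 1)) = v (p * i + 1 + r) := by
  induction r with
  | zero => rfl
  | succ r ih =>
    rw [pow_succ', Module.End.mul_apply, ih (by omega), LieAlgebra.ad_apply,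
      hb.lie_x_v hy (by omega)]
    · rfl
    · intro h
      rw [add_assoc] at h
      have := Nat.le_of_dvd (by omega) ((Nat.dvd_add_right (Dvd.intro i rfl)).mp h)
      omega

lemma ad_x_pow_char (hb : IsStandardBasis 𝒜 x y v) (hy : ∀ k, 1 ≤ k → ¬ p ∣ k → ⁅y, v k⁆ = 0)
    (hp : 0 < p) {i : ℕ} {a : F}
    (ha : ⁅x, v (p * i)⁆ = a • v (p * i + 1)) :
    (LieAlgebra.ad F L x ^ p) (v (p * i)) = a • v (p * (i + 1)) := by
  obtain ⟨r, rfl⟩ : ∃ r, p = r + 1 := ⟨p - 1, by omega⟩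
  rw [pow_succ, Module.End.mul_apply, LieAlgebra.ad_apply, ha, map_smul,
    hb.ad_x_pow hy (by omega)]
  congr 2; ring

/-- Each step moves one `ad x` from the left factor to the right; the bound on `r + t` keeps the
right factor short of the next multiple of `p`, where `y` could act. -/
lemma lie_v_v_eq_zero (hb : IsStandardBasis 𝒜 x y v) (hy : ∀ k, 1 ≤ k → ¬ p ∣ k → ⁅y, v k⁆ = 0)
    {i r t : ℕ} (ht : 1 ≤ t) (hrt : r + t < p) :
    ⁅v (r + 1), v (p * i + t)⁆ = 0 := by
  have hnd : ∀ s, 1 ≤ s → s < p → ¬ p ∣ p * i + s := fun s hs hsp h => by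
    have := Nat.le_of_dvd (by omega) ((Nat.dvd_add_right (Dvd.intro i rfl)).mp h)
    omega
  induction r generalizing t with
  | zero => rw [zero_add, hb.v_one, hy _ (by omega) (hnd t ht (by omega))]
  | succ r ih =>
    rw [← hb.lie_x_v hy (k := r + 1) (by omega) (fun h => by
      have := Nat.le_of_dvd (by omega) h; omega), lie_lie, ih ht (by omega), lie_zero, zero_sub,
      hb.lie_x_v hy (by omega) (hnd t ht (by omega)), add_assoc, ih (by omega) (by omega),
      neg_zero]

/-- In the Jacobi expansion the term with `a` is zero by `lie_v_v_eq_zero`, so only the action of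
`y` survives. -/
lemma lie_v_v_mul (hb : IsStandardBasis 𝒜 x y v) (hy : ∀ k, 1 ≤ k → ¬ p ∣ k → ⁅y, v k⁆ = 0)
    {i r : ℕ} (hr : r < p) {a b : F}
    (ha : ⁅x, v (p * i)⁆ = a • v (p * i + 1)) (hb' : ⁅y, v (p * i)⁆ = b • v (p * i + 1)) :
    ⁅v (r + 1), v (p * i)⁆ = b • v (p * i + 1 + r) := by
  induction r with
  | zero => rw [zero_add, hb.v_one, hb']
  | succ r ih =>
    rw [← hb.lie_x_v hy (k := r + 1) (by omega) (fun h => by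
      have := Nat.le_of_dvd (by omega) h; omega), lie_lie, ih (by omega), ha, lie_smul, lie_smul,
      hb.lie_v_v_eq_zero hy le_rfl (by omega), smul_zero, sub_zero, hb.lie_x_v hy (by omega)]
    · rfl
    · intro h
      rw [add_assoc] at h
      have := Nat.le_of_dvd (by omega) ((Nat.dvd_add_right (Dvd.intro i rfl)).mp h)
      omega

end IsStandardBasis

/-! ### Isomorphism with the inflation of the deflation -/

/-- In an algebra generated by its component of weight one, a linear map which preserves brackets
with elements of weight one preserves all brackets. -/
lemma IsMaximalClass.map_lie_of_map_lie_one {F L L' : Type*} [Field F] [LieRing L] [LieAlgebra F L]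
    [LieRing L'] [LieAlgebra F L'] {𝒜 : ℕ → Submodule F L} [GradedLieAlgebra 𝒜]
    (hL : IsMaximalClass 𝒜) (e : L →ₗ[F] L') (he : ∀ a ∈ 𝒜 1, ∀ b, e ⁅a, b⁆ = ⁅e a, e b⁆)
    (a b : L) : e ⁅a, b⁆ = ⁅e a, e b⁆ := by
  let H : LieSubalgebra F L :=
    { carrier := {a | ∀ b, e ⁅a, b⁆ = ⁅e a, e b⁆}
      add_mem' := fun ha ha' b => by rw [add_lie, map_add, ha b, ha' b, map_add, add_lie]
      zero_mem' := fun b => by simp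
      smul_mem' := fun c a ha b => by rw [smul_lie, map_smul, ha b, map_smul, smul_lie]
      lie_mem' := fun {a a'} ha ha' b => by
        rw [lie_lie, map_sub, ha, ha', ha', ha, ha, lie_lie] }
  have hH : H = ⊤ := top_le_iff.mp (hL.generated ▸ LieSubalgebra.lieSpan_le.mpr he)
  exact (show a ∈ H from hH ▸ LieSubalgebra.mem_top a) b

lemma exists_eq_mul_sub (p : ℕ) (hp : 0 < p) {k : ℕ} (hk : 1 ≤ k) :
    ∃ i j, j < p ∧ k = p * (i + 1) - j ∧ k + j = p * (i + 1) := by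
  have h1 := Nat.div_add_mod (k - 1) p
  have h2 := Nat.mod_lt (k - 1) hp
  refine ⟨(k - 1) / p, p - 1 - (k - 1) % p, by omega, ?_, ?_⟩ <;> rw [mul_add, mul_one] <;> omega

lemma not_dvd_mul_sub {p : ℕ} (i : ℕ) {j : ℕ} (h1 : 1 ≤ j) (h2 : j < p) :
    ¬ p ∣ p * (i + 1) - j := by
  intro h
  have h3 : p ≤ p * (i + 1) := Nat.le_mul_of_pos_right p i.succ_pos
  have h4 := (Nat.dvd_sub_iff_right (show j ≤ p * (i + 1) by omega) (Dvd.intro _ rfl)).mp h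
  have := Nat.le_of_dvd h1 h4
  omega

lemma one_le_mul_sub {p : ℕ} (i : ℕ) {j : ℕ} (h : j < p) : 1 ≤ p * (i + 1) - j := by
  have h3 : p ≤ p * (i + 1) := Nat.le_mul_of_pos_right p i.succ_pos
  omega

/-- The weight after a multiple of `p` opens the next block, where the exponent of `ε` is `p - 1`.
-/
lemma mul_add_one_eq_mul_sub {p : ℕ} [Fact p.Prime] (i : ℕ) :
    p * (i + 1) + 1 = p * (i + 1 + 1) - (p - 1) := by
  rw [mul_add p (i + 1), mul_one]
  have := (Fact.out : p.Prime).pos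
  omega

/-- It is enough to check that brackets with `u` are preserved on the elements of a standard
basis. -/
lemma map_lie_ext {F L L' : Type*} [Field F] [LieRing L] [LieAlgebra F L] [LieRing L']
    [LieAlgebra F L'] {𝒜 : ℕ → Submodule F L} [GradedLieAlgebra 𝒜] {x y : L} {v : ℕ → L} {p : ℕ}
    [Fact p.Prime] (hL : IsMaximalClass 𝒜) (hb : IsStandardBasis 𝒜 x y v) (e : L →ₗ[F] L')
    {u : L} (hux : e ⁅u, x⁆ = ⁅e u, e x⁆)
    (huv : ∀ i j, j < p → e ⁅u, v (p * (i + 1) - j)⁆ = ⁅e u, e (v (p * (i + 1) - j))⁆) (w : L) :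
    e ⁅u, w⁆ = ⁅e u, e w⁆ := by
  obtain ⟨B, hBx, hBv⟩ := hb.exists_basis hL
  refine LinearMap.congr_fun (f := e ∘ₗ LieAlgebra.ad F L u)
    (g := LieAlgebra.ad F L' (e u) ∘ₗ e) (B.ext ?_) w
  rintro (_ | k)
  · rw [hBx]; exact hux
  · obtain ⟨i, j, hj, hk, -⟩ :=
      exists_eq_mul_sub p (Fact.out : p.Prime).pos (k := k + 1) (by omega)
    rw [hBv, hk]; exact huv i j hj

/-! ### A basis of the ideal `⨁_i L_{pi}` of the deflation. -/

section DeflationBasis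

variable {F L : Type*} [Field F] [LieRing L] [LieAlgebra F L]
  {𝒜 : ℕ → Submodule F L} [GradedLieAlgebra 𝒜] {x y : L} {v : ℕ → L} (p : ℕ) [Fact p.Prime]
  [CharP F p]

/-- The element `v_{p(i+1)}` of the ideal `⨁_i L_{pi}` of the deflation. -/
def deflationVec (hb : IsStandardBasis 𝒜 x y v) (i : ℕ) :
    DerivExt.leftIdeal (adPowDerivation p 𝒜 ⟨x, hb.x_mem⟩) :=
  ⟨DerivExt.inl _ ⟨v (p * (i + 1)), Submodule.mem_iSup_of_mem (i + 1)
    (hb.v_mem (Nat.mul_pos (Fact.out : p.Prime).pos i.succ_pos))⟩, rfl⟩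

/-- The inclusion of the ideal `⨁_i L_{pi}` of the deflation in `L`. -/
def leftIdealIncl (z : 𝒜 1) : DerivExt.leftIdeal (adPowDerivation p 𝒜 z) →ₗ[F] L where
  toFun m := ((m : Deflation p 𝒜 z).left : L)
  map_add' _ _ := rfl
  map_smul' _ _ := rfl

lemma leftIdealIncl_injective (z : 𝒜 1) : Function.Injective (leftIdealIncl p z) := by
  intro m m' h
  refine Subtype.ext (DerivExt.ext (Subtype.ext h) ?_)
  rw [show (m : Deflation p 𝒜 z).right = 0 from m.2,
    show (m' : Deflation p 𝒜 z).right = 0 from m'.2]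

variable {p} in
@[simp] lemma leftIdealIncl_deflationVec (hb : IsStandardBasis 𝒜 x y v) (i : ℕ) :
    leftIdealIncl p _ (deflationVec p hb i) = v (p * (i + 1)) := rfl

lemma two_le_mul (i : ℕ) : 2 ≤ p * (i + 1) :=
  (Fact.out : p.Prime).two_le.trans (Nat.le_mul_of_pos_right p i.succ_pos)

lemma mem_span_deflationVec (hL : IsMaximalClass 𝒜) (hb : IsStandardBasis 𝒜 x y v)
    (m : DerivExt.leftIdeal (adPowDerivation p 𝒜 ⟨x, hb.x_mem⟩)) :
    m ∈ Submodule.span F (Set.range (deflationVec p hb)) := by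
  have h : leftIdealIncl p _ m ∈
      (Submodule.span F (Set.range (deflationVec p hb))).map (leftIdealIncl p _) := by
    have hle : ⨆ i, 𝒜 (p * i) ≤
        (Submodule.span F (Set.range (deflationVec p hb))).map (leftIdealIncl p _) := by
      rw [iSup_le_iff]
      rintro (_ | i)
      · rw [mul_zero, hL.zero_eq_bot]; exact bot_le
      · rw [hb.span _ (two_le_mul p i), Submodule.span_singleton_le_iff_mem]
        exact ⟨deflationVec p hb i, Submodule.subset_span ⟨i, rfl⟩, rfl⟩
    exact hle (m : Deflation p 𝒜 ⟨x, hb.x_mem⟩).left.2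
  obtain ⟨m', hm', heq⟩ := h
  rwa [← leftIdealIncl_injective p _ heq]

lemma exists_basis_leftIdeal (hL : IsMaximalClass 𝒜) (hb : IsStandardBasis 𝒜 x y v) :
    ∃ B : Module.Basis ℕ F (DerivExt.leftIdeal (adPowDerivation p 𝒜 ⟨x, hb.x_mem⟩)),
      ∀ i, B i = deflationVec p hb i := by
  have hindep : iSupIndep 𝒜 := (DirectSum.Decomposition.isInternal 𝒜).submodule_iSupIndep
  have hli : LinearIndependent F (deflationVec p hb) := by
    refine LinearIndependent.of_comp (leftIdealIncl p _) ?_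
    refine (hindep.comp (f := fun i => p * (i + 1)) fun i j hij => ?_).linearIndependent _
      (fun i => hb.v_mem (one_le_two.trans (two_le_mul p i)))
      fun i => hb.v_ne_zero _ (one_le_two.trans (two_le_mul p i))
    have := Nat.eq_of_mul_eq_mul_left (Fact.out : p.Prime).pos hij
    omega
  exact ⟨Module.Basis.mk hli fun m _ => mem_span_deflationVec p hL hb m,
    fun i => Module.Basis.mk_apply _ _ i⟩

variable {p} in
lemma deflationVec_mem (hb : IsStandardBasis 𝒜 x y v) (i : ℕ) :
    (deflationVec p hb i : Deflation p 𝒜 ⟨x, hb.x_mem⟩) ∈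
      deflationGrading p 𝒜 ⟨x, hb.x_mem⟩ (i + 1) :=
  Submodule.mem_sup_left ⟨_, hb.v_mem (one_le_two.trans (two_le_mul p i)), rfl⟩

variable {p} in
lemma exists_smul_deflationVec (hb : IsStandardBasis 𝒜 x y v) {i : ℕ}
    {m : DerivExt.leftIdeal (adPowDerivation p 𝒜 ⟨x, hb.x_mem⟩)}
    (hm : (m : Deflation p 𝒜 ⟨x, hb.x_mem⟩) ∈ deflationGrading p 𝒜 ⟨x, hb.x_mem⟩ (i + 1)) :
    ∃ c : F, m = c • deflationVec p hb i := by
  have hleft : leftIdealIncl p _ m ∈ 𝒜 (p * (i + 1)) := by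
    obtain ⟨_, ⟨a, ha, rfl⟩, g, hg, hag⟩ := Submodule.mem_sup.mp hm
    have hgl : g.left = 0 := by
      split_ifs at hg
      · obtain ⟨c, rfl⟩ := Submodule.mem_span_singleton.mp hg
        exact smul_zero c
      · rw [(Submodule.mem_bot F).mp hg]; rfl
    have : (m : Deflation p 𝒜 ⟨x, hb.x_mem⟩).left = a := by
      rw [← hag]
      change a + g.left = a
      rw [hgl, add_zero]
    change ((m : Deflation p 𝒜 ⟨x, hb.x_mem⟩).left : L) ∈ _
    rw [this]; exact ha
  rw [hb.span _ (two_le_mul p i)] at hleft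
  obtain ⟨c, hc⟩ := Submodule.mem_span_singleton.mp hleft
  exact ⟨c, leftIdealIncl_injective p _ (by rw [map_smul, leftIdealIncl_deflationVec, hc])⟩

lemma eq_zero_of_mem_deflationGrading_zero (hL : IsMaximalClass 𝒜) (z : 𝒜 1)
    {m : Deflation p 𝒜 z} (hm : m ∈ deflationGrading p 𝒜 z 0) : m = 0 := by
  rw [deflationGrading, if_neg zero_ne_one, sup_bot_eq, mul_zero, hL.zero_eq_bot] at hm
  obtain ⟨a, ha, rfl⟩ := hm
  have : a = 0 := Subtype.ext ((Submodule.mem_bot F).mp ha)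
  rw [this, map_zero]

variable {p} in
lemma leftIdeal_toSubmodule (hL : IsMaximalClass 𝒜) (hb : IsStandardBasis 𝒜 x y v) :
    (DerivExt.leftIdeal (adPowDerivation p 𝒜 ⟨x, hb.x_mem⟩)).toSubmodule =
      Submodule.span F {(deflationVec p hb 0 : Deflation p 𝒜 ⟨x, hb.x_mem⟩)} ⊔
        ⨆ i, ⨆ (_ : 2 ≤ i), deflationGrading p 𝒜 ⟨x, hb.x_mem⟩ i := by
  refine le_antisymm ?_ (sup_le ?_ (iSup_le fun i => iSup_le fun hi => ?_))
  · intro m hm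
    have h := mem_span_deflationVec p hL hb ⟨m, hm⟩
    have h' := Submodule.mem_map_of_mem (f := Submodule.subtype
      (DerivExt.leftIdeal (adPowDerivation p 𝒜 ⟨x, hb.x_mem⟩)).toSubmodule) h
    rw [Submodule.map_span] at h'
    refine Submodule.span_le.mpr ?_ h'
    rintro _ ⟨_, ⟨i, rfl⟩, rfl⟩
    by_cases hi : i = 0
    · subst hi
      exact Submodule.mem_sup_left (Submodule.mem_span_singleton_self _)
    · exact Submodule.mem_sup_right (Submodule.mem_iSup_of_mem (i + 1)
        (Submodule.mem_iSup_of_mem (by omega) (deflationVec_mem hb i)))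
  · rw [Submodule.span_singleton_le_iff_mem]
    exact (deflationVec p hb 0).2
  · rw [deflationGrading, if_neg (by omega), sup_bot_eq]
    rintro _ ⟨a, -, rfl⟩
    exact rfl

end DeflationBasis

/-! ### Construction and verification of the isomorphism with the inflation. -/

section Isomorphism

variable {F L : Type*} [Field F] [LieRing L] [LieAlgebra F L]
  {𝒜 : ℕ → Submodule F L} [GradedLieAlgebra 𝒜] {x y : L} {v : ℕ → L} {p : ℕ} [Fact p.Prime]
  [CharP F p]

/-- The linear isomorphism between `L` and the inflation of its deflation. -/
lemma exists_linearEquiv_inflation (hL : IsMaximalClass 𝒜) (hb : IsStandardBasis 𝒜 x y v)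
    (s : Deflation p 𝒜 ⟨x, hb.x_mem⟩) :
    ∃ e : L ≃ₗ[F] Inflation p (DerivExt.leftIdeal (adPowDerivation p 𝒜 ⟨x, hb.x_mem⟩)) s,
      e x = DerivExt.gen _ ∧ ∀ i j, j < p → e (v (p * (i + 1) - j)) =
        ((j.factorial : ℕ) : F)⁻¹ • DerivExt.inl _ ((eps F p ^ j) ⊗ₜ deflationVec p hb i) := by
  obtain ⟨B, hBx, hBv⟩ := hb.exists_basis hL
  obtain ⟨B₁, hB₁⟩ := exists_basis_leftIdeal p hL hb
  obtain ⟨B₂, hB₂⟩ := exists_basis_trunc F p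
  have : NeZero p := ⟨(Fact.out : p.Prime).ne_zero⟩
  let B₃ := (((B₂.isUnitSMul (isUnit_inv_factorial (F := F))).tensorProduct B₁).prod
    (Module.Basis.singleton PUnit.{1} F)).map (DerivExt.prodEquiv
      (inflationDerivation p (DerivExt.leftIdeal (adPowDerivation p 𝒜 ⟨x, hb.x_mem⟩)) s))
  -- Since `B (some k)` is `v (k + 1)`, the pair `(j, i)` must go to `p * i + (p - 1 - j)`: division
  -- with remainder, with the remainder reversed.
  let τ₁ : Fin p × ℕ ≃ ℕ := ((Equiv.prodComm _ _).trans
    ((Equiv.refl ℕ).prodCongr Fin.revPerm)).trans (Nat.divModEquiv p).symm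
  let τ : (Fin p × ℕ) ⊕ PUnit.{1} ≃ Option ℕ :=
    (Equiv.optionEquivSumPUnit _).symm.trans (Equiv.optionCongr τ₁)
  let e := (B₃.equiv B τ).symm
  have he : ∀ o, e (B (τ o)) = B₃ o := fun o => by
    rw [LinearEquiv.symm_apply_eq, Module.Basis.equiv_apply]
  refine ⟨e, ?_, fun i j hj => ?_⟩
  · have h := he (Sum.inr PUnit.unit)
    rw [show τ (Sum.inr PUnit.unit) = none from rfl, hBx] at h
    rw [h]
    simp only [B₃, Module.Basis.map_apply, Module.Basis.prod_apply]
    simp only [Sum.elim_inr, Function.comp_apply, Module.Basis.singleton_apply,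
      LinearMap.inr_apply]
    rfl
  · have h := he (Sum.inl (⟨j, hj⟩, i))
    rw [show τ (Sum.inl (⟨j, hj⟩, i)) = some (i * p + (p - (j + 1))) from rfl, hBv,
      show i * p + (p - (j + 1)) + 1 = p * (i + 1) - j by
        rw [mul_add, mul_comm, mul_one]; omega] at h
    rw [h]
    simp only [B₃, Module.Basis.map_apply, Module.Basis.prod_apply]
    simp only [Sum.elim_inl, Function.comp_apply, LinearMap.inl_apply,
      Module.Basis.tensorProduct_apply, Module.Basis.isUnitSMul_apply, hB₁, hB₂]
    rw [← map_smul, TensorProduct.smul_tmul']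
    rfl

lemma lie_neg_gen_deflationVec (hb : IsStandardBasis 𝒜 x y v)
    (hy : ∀ k, 1 ≤ k → ¬ p ∣ k → ⁅y, v k⁆ = 0) {i : ℕ} {a : F}
    (ha : ⁅x, v (p * (i + 1))⁆ = a • v (p * (i + 1) + 1)) :
    ⁅-DerivExt.gen (adPowDerivation p 𝒜 ⟨x, hb.x_mem⟩), deflationVec p hb i⁆ =
      -(a • deflationVec p hb (i + 1)) := by
  refine leftIdealIncl_injective p _ ?_
  rw [map_neg, map_smul, leftIdealIncl_deflationVec,
    ← hb.ad_x_pow_char hy (Fact.out : p.Prime).pos ha]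
  change (((⁅-DerivExt.gen (adPowDerivation p 𝒜 ⟨x, hb.x_mem⟩),
    (deflationVec p hb i : Deflation p 𝒜 ⟨x, hb.x_mem⟩)⁆ :
    Deflation p 𝒜 ⟨x, hb.x_mem⟩).left : multiplesSubalgebra p 𝒜) : L) = _
  rw [neg_lie]
  change -(((⁅DerivExt.gen (adPowDerivation p 𝒜 ⟨x, hb.x_mem⟩), DerivExt.inl _ _⁆ :
    Deflation p 𝒜 ⟨x, hb.x_mem⟩).left : multiplesSubalgebra p 𝒜) : L) = _
  rw [DerivExt.lie_gen_inl]
  rfl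

/-- Since `v p` is `v (r + 1)` with `r = p - 1`, `lie_v_v_mul` shows that it acts in the deflation
as `y` acts in `L`. -/
lemma lie_deflationVec_zero (hb : IsStandardBasis 𝒜 x y v)
    (hy : ∀ k, 1 ≤ k → ¬ p ∣ k → ⁅y, v k⁆ = 0) {i : ℕ} {b : F}
    (hb' : ⁅y, v (p * (i + 1))⁆ = b • v (p * (i + 1) + 1)) :
    ⁅deflationVec p hb 0, deflationVec p hb i⁆ = b • deflationVec p hb (i + 1) := by
  have hp := (Fact.out : p.Prime).pos
  obtain ⟨a, b₁, hab⟩ := hb.exists_scalars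
  have ha := (hab _ (one_le_two.trans (two_le_mul p i))).1
  refine leftIdealIncl_injective p _ ?_
  rw [map_smul, leftIdealIncl_deflationVec]
  change (((⁅DerivExt.inl (adPowDerivation p 𝒜 ⟨x, hb.x_mem⟩) _, DerivExt.inl _ _⁆ :
    Deflation p 𝒜 ⟨x, hb.x_mem⟩).left : multiplesSubalgebra p 𝒜) : L) = _
  rw [DerivExt.lie_inl_inl]
  change ⁅v (p * (0 + 1)), v (p * (i + 1))⁆ = _
  rw [show p * (0 + 1) = p - 1 + 1 by omega,
    hb.lie_v_v_mul hy (i := i + 1) (r := p - 1) (by omega) ha hb']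
  congr 2
  rw [mul_add p (i + 1)]
  omega

section MapLie

variable {N : Type*} [LieRing N] [LieAlgebra F N] {I : LieIdeal F N} {s : N} {m : ℕ → I}

lemma map_lie_x (hL : IsMaximalClass 𝒜) (hb : IsStandardBasis 𝒜 x y v)
    (hy : ∀ k, 1 ≤ k → ¬ p ∣ k → ⁅y, v k⁆ = 0)
    (hms : ∀ (i : ℕ) (a : F), ⁅x, v (p * (i + 1))⁆ = a • v (p * (i + 1) + 1) →
      ⁅s, m i⁆ = -(a • m (i + 1)))
    (e : L →ₗ[F] Inflation p I s) (hex : e x = DerivExt.gen _)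
    (hev : ∀ i j, j < p → e (v (p * (i + 1) - j)) =
      ((j.factorial : ℕ) : F)⁻¹ • DerivExt.inl _ ((eps F p ^ j) ⊗ₜ m i))
    (w : L) : e ⁅x, w⁆ = ⁅e x, e w⁆ := by
  have hp := (Fact.out : p.Prime).pos
  refine map_lie_ext (p := p) hL hb e (by rw [lie_self, lie_self, map_zero]) (fun i j hj => ?_) w
  rw [hev i j hj, hex, lie_smul, DerivExt.lie_gen_inl, inflationDerivation_tmul]
  -- At `j = 0` the derivative vanishes and `ε^{p-1} ⊗ ad s` carries the image to the next block,
  -- the minus in `s` matching `1 / (p - 1)! = -1`. For positive exponents the other summand is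
  -- killed by `ε ^ p = 0`.
  rcases j with _ | j
  · obtain ⟨a, _, hab⟩ := hb.exists_scalars
    have ha := (hab _ (one_le_two.trans (two_le_mul p i))).1
    rw [Nat.sub_zero, ha, map_smul, mul_add_one_eq_mul_sub, hev (i + 1) (p - 1) (by omega),
      hms i _ ha, inv_factorial_pred, Nat.cast_zero, zero_smul, zero_add, add_zero,
      Nat.factorial_zero, Nat.cast_one, inv_one, one_smul, TensorProduct.tmul_neg,
      TensorProduct.tmul_smul, map_neg, map_smul, neg_one_smul, smul_neg]
  · have hj0 : ((j + 1 : ℕ) : F) ≠ 0 := fun h0 => by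
      have := Nat.le_of_dvd (by omega) ((CharP.cast_eq_zero_iff F p _).mp h0)
      omega
    have hfac : (((j + 1).factorial : ℕ) : F)⁻¹ * ((j + 1 : ℕ) : F) =
        ((j.factorial : ℕ) : F)⁻¹ := by
      rw [Nat.factorial_succ, Nat.cast_mul, mul_inv, mul_comm, ← mul_assoc,
        mul_inv_cancel₀ hj0, one_mul]
    rw [hb.lie_x_v hy (one_le_mul_sub i hj) (not_dvd_mul_sub i (by omega) hj),
      show p * (i + 1) - (j + 1) + 1 = p * (i + 1) - j by
        have := one_le_mul_sub i hj; omega,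
      hev i j (by omega), eps_pow_eq_zero F p (n := p - 1 + (j + 1)) (by omega),
      TensorProduct.zero_tmul, add_zero, map_smul, smul_smul, hfac, Nat.add_sub_cancel]

lemma map_lie_y (hL : IsMaximalClass 𝒜) (hb : IsStandardBasis 𝒜 x y v)
    (hy : ∀ k, 1 ≤ k → ¬ p ∣ k → ⁅y, v k⁆ = 0)
    (hmm : ∀ (i : ℕ) (b : F), ⁅y, v (p * (i + 1))⁆ = b • v (p * (i + 1) + 1) →
      ⁅m 0, m i⁆ = b • m (i + 1))
    (e : L →ₗ[F] Inflation p I s) (hxy : e ⁅x, y⁆ = ⁅e x, e y⁆)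
    (hev : ∀ i j, j < p → e (v (p * (i + 1) - j)) =
      ((j.factorial : ℕ) : F)⁻¹ • DerivExt.inl _ ((eps F p ^ j) ⊗ₜ m i))
    (w : L) : e ⁅y, w⁆ = ⁅e y, e w⁆ := by
  have hp := (Fact.out : p.Prime).pos
  refine map_lie_ext (p := p) hL hb e (by rw [← lie_skew, map_neg, hxy, lie_skew])
    (fun i j hj => ?_) w
  obtain ⟨_, b, hab⟩ := hb.exists_scalars
  have hb' := (hab _ (one_le_two.trans (two_le_mul p i))).2.1
  have hey : e y = ((((p - 1).factorial : ℕ) : F)⁻¹ •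
      DerivExt.inl _ ((eps F p ^ (p - 1)) ⊗ₜ m 0)) := by
    rw [← hev 0 (p - 1) (by omega), ← hb.v_one]
    congr 2; omega
  rw [hev i j hj, hey, lie_smul, smul_lie, DerivExt.lie_inl_inl,
    LieAlgebra.ExtendScalars.bracket_tmul, ← pow_add, hmm i _ hb']
  -- The image of `y` is a multiple of `ε^{p-1} ⊗ m 0`, so it kills all positive powers of `ε`, just
  -- as `y` acts only in weights divisible by `p`.
  rcases j with _ | j
  · rw [Nat.sub_zero, hb', map_smul, mul_add_one_eq_mul_sub,
      hev (i + 1) (p - 1) (by omega), add_zero, TensorProduct.tmul_smul, map_smul,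
      Nat.factorial_zero, Nat.cast_one, inv_one, one_smul, smul_comm]
  · rw [hy _ (one_le_mul_sub i hj) (not_dvd_mul_sub i (by omega) hj), map_zero,
      eps_pow_eq_zero F p (n := p - 1 + (j + 1)) (by omega), TensorProduct.zero_tmul, map_zero,
      smul_zero, smul_zero]

/-- A linear map from `L` to an inflation which maps a standard basis as prescribed is a
homomorphism of Lie algebras. -/
lemma map_lie_of_map_basis (hL : IsMaximalClass 𝒜) (hb : IsStandardBasis 𝒜 x y v)
    (hy : ∀ k, 1 ≤ k → ¬ p ∣ k → ⁅y, v k⁆ = 0)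
    (hms : ∀ (i : ℕ) (a : F), ⁅x, v (p * (i + 1))⁆ = a • v (p * (i + 1) + 1) →
      ⁅s, m i⁆ = -(a • m (i + 1)))
    (hmm : ∀ (i : ℕ) (b : F), ⁅y, v (p * (i + 1))⁆ = b • v (p * (i + 1) + 1) →
      ⁅m 0, m i⁆ = b • m (i + 1))
    (e : L →ₗ[F] Inflation p I s) (hex : e x = DerivExt.gen _)
    (hev : ∀ i j, j < p → e (v (p * (i + 1) - j)) =
      ((j.factorial : ℕ) : F)⁻¹ • DerivExt.inl _ ((eps F p ^ j) ⊗ₜ m i))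
    (u w : L) : e ⁅u, w⁆ = ⁅e u, e w⁆ := by
  have hdx := map_lie_x hL hb hy hms e hex hev
  have hdy := map_lie_y hL hb hy hmm e (hdx y) hev
  refine hL.map_lie_of_map_lie_one e (fun u hu w => ?_) u w
  rw [hb.span_one] at hu
  obtain ⟨α, β, rfl⟩ := Submodule.mem_span_pair.mp hu
  rw [add_lie, smul_lie, smul_lie, map_add, map_smul, map_smul, hdx, hdy, map_add, map_smul,
    map_smul, add_lie, smul_lie, smul_lie]

end MapLie

lemma map_component_of_map_basis (hL : IsMaximalClass 𝒜) (hb : IsStandardBasis 𝒜 x y v)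
    {s : Deflation p 𝒜 ⟨x, hb.x_mem⟩}
    (e : L ≃ₗ[F] Inflation p (DerivExt.leftIdeal (adPowDerivation p 𝒜 ⟨x, hb.x_mem⟩)) s)
    (hex : e x = DerivExt.gen _)
    (hev : ∀ i j, j < p → e (v (p * (i + 1) - j)) =
      ((j.factorial : ℕ) : F)⁻¹ • DerivExt.inl _ ((eps F p ^ j) ⊗ₜ deflationVec p hb i))
    (k : ℕ) : (𝒜 k).map e.toLinearMap =
      inflationGrading p (deflationGrading p 𝒜 ⟨x, hb.x_mem⟩) _ s k := by
  have hv : ∀ k, 1 ≤ k → e (v k) ∈ inflationGrading p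
      (deflationGrading p 𝒜 ⟨x, hb.x_mem⟩) _ s k := by
    intro k hk
    obtain ⟨i, j, hj, hk', hkj⟩ := exists_eq_mul_sub p (Fact.out : p.Prime).pos hk
    rw [congrArg v hk', hev i j hj]
    exact Submodule.mem_sup_left (Submodule.smul_mem _ _ (Submodule.subset_span
      ⟨i + 1, j, deflationVec p hb i, hj, hkj, deflationVec_mem hb i, rfl⟩))
  refine le_antisymm ?_ (sup_le (Submodule.span_le.mpr ?_) ?_)
  · rw [Submodule.map_le_iff_le_comap]
    match k with
    | 0 => rw [hL.zero_eq_bot]; exact bot_le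
    | 1 =>
      refine hb.span_one.le.trans (Submodule.span_le.mpr ?_)
      rintro u (hu | hu)
      · rw [hu]
        change e x ∈ inflationGrading p (deflationGrading p 𝒜 ⟨x, hb.x_mem⟩) _ s 1
        rw [hex]
        refine Submodule.mem_sup_right ?_
        rw [if_pos rfl]
        exact Submodule.mem_span_singleton_self _
      · rw [show u = v 1 from hu.trans hb.v_one.symm]
        exact hv 1 le_rfl
    | k + 2 =>
      rw [hb.span _ (by omega), Submodule.span_singleton_le_iff_mem]
      exact hv _ (by omega)
  · rintro _ ⟨i, j, m, hj, hkj, hm, rfl⟩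
    rcases i with _ | i
    · have : m = 0 := Subtype.ext (eq_zero_of_mem_deflationGrading_zero p hL _ hm)
      rw [this, TensorProduct.tmul_zero, map_zero]
      exact zero_mem _
    · obtain ⟨c, rfl⟩ := exists_smul_deflationVec hb hm
      have hk1 := one_le_mul_sub i hj
      have hk : p * (i + 1) - j = k := by omega
      -- The factor `j!` cancels the denominator in the image of `v k`.
      refine ⟨(c * ((j.factorial : ℕ) : F)) • v k,
        Submodule.smul_mem _ _ (hb.v_mem (hk ▸ hk1)), ?_⟩
      change e _ = _
      rw [map_smul, ← hk, hev i j hj, smul_smul, mul_assoc, mul_inv_cancel₀, mul_one,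
        TensorProduct.tmul_smul, map_smul]
      exact fun h => (isUnit_inv_factorial (F := F) ⟨j, hj⟩).ne_zero (by rw [h, inv_zero])
  · split_ifs with hk
    · subst hk
      rw [Submodule.span_singleton_le_iff_mem]
      exact ⟨x, hb.x_mem, hex⟩
    · exact bot_le

/-- If `y` acts nontrivially only on components whose weight is a multiple of `p`, then `L` is
inflated. -/
theorem IsStandardBasis.isInflated (hL : IsMaximalClass 𝒜) (hb : IsStandardBasis 𝒜 x y v)
    (hy : ∀ k, 1 ≤ k → ¬ p ∣ k → ⁅y, v k⁆ = 0) : IsInflated p 𝒜 := by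
  obtain ⟨e, hex, hev⟩ := exists_linearEquiv_inflation (p := p) hL hb
    (-DerivExt.gen (adPowDerivation p 𝒜 ⟨x, hb.x_mem⟩))
  have hx2 : x ∉ twoStepCentralizer 𝒜 2 := fun h => by
    have h1 := h.2 (v 2) (hb.v_mem (by omega))
    rw [← lie_skew, neg_eq_zero, hb.lie_x_of_lie_y_eq_zero (by omega) hb.lie_y_two] at h1
    exact hb.v_ne_zero _ (by omega) h1
  have hvec0 : (deflationVec p hb 0 : Deflation p 𝒜 ⟨x, hb.x_mem⟩) ≠ 0 := fun h =>
    hb.v_ne_zero _ (one_le_two.trans (two_le_mul p 0)) (by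
      rw [← leftIdealIncl_deflationVec hb 0, show deflationVec p hb 0 = 0 from Subtype.ext h,
        map_zero])
  have hlie : ∀ u w, e ⁅u, w⁆ = ⁅e u, e w⁆ := map_lie_of_map_basis
    (m := deflationVec p hb) hL hb hy (fun _ _ h => lie_neg_gen_deflationVec hb hy h)
    (fun _ _ h => lie_deflationVec_zero hb hy h) e.toLinearMap hex hev
  refine ⟨⟨x, hb.x_mem⟩, hx2,
    Submodule.span F {(deflationVec p hb 0 : Deflation p 𝒜 ⟨x, hb.x_mem⟩)}, ?_,
    finrank_span_singleton hvec0, DerivExt.leftIdeal (adPowDerivation p 𝒜 ⟨x, hb.x_mem⟩),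
    leftIdeal_toSubmodule hL hb, -DerivExt.gen (adPowDerivation p 𝒜 ⟨x, hb.x_mem⟩), ?_, ?_,
    { e with map_lie' := fun {u w} => hlie u w },
    fun k => map_component_of_map_basis hL hb e hex hev k⟩
  · rw [Submodule.span_singleton_le_iff_mem]
    exact deflationVec_mem hb 0
  · refine Submodule.mem_sup_right ?_
    rw [if_pos rfl]
    exact neg_mem (Submodule.mem_span_singleton_self _)
  · intro h
    obtain ⟨c, hc⟩ := Submodule.mem_span_singleton.mp h
    have h1 := congrArg DerivExt.right hc
    change c • (0 : F) = -1 at h1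
    rw [smul_zero] at h1
    exact one_ne_zero (neg_eq_zero.mp h1.symm)

end Isomorphism

end MaximalClass

theorem mainTheorem3 {F L : Type*} [Field F] [LieRing L] [LieAlgebra F L]
    (p : ℕ) [Fact p.Prime] [CharP F p] (hp : p ≠ 2)
    (𝒜 : ℕ → Submodule F L) [GradedLieAlgebra 𝒜] (hL : MaximalClass.IsMaximalClass 𝒜)
    (hinf : ¬ Module.Finite F L)
    (hthree : 3 ≤ (MaximalClass.twoStepCentralizers 𝒜).encard) :
    (∃ h : ℕ, 1 ≤ h ∧ MaximalClass.IsParameter 𝒜 (p ^ h) ∧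
      ∀ a b m : ℕ, MaximalClass.IsConstituent 𝒜 a b m → m = p ^ h ∨ m = 2 * p ^ h) ∧
    MaximalClass.IsInflated p 𝒜 := by
  obtain ⟨x, y, v, hb⟩ := hL.exists_isStandardBasis hinf
  obtain ⟨hc, hy⟩ := hb.constituents p hp hthree
  exact ⟨hc, hb.isInflated hL hy⟩
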